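/- **Setting.** $M\ge 1$ transmitters (TXs), TX $j$ having $N_j$ antennas, jointly serve $K$ single-antenna receivers over a channel $\mathbf H\in\mathbb C^{K\times N_T}$, $N_T=\sum_j N_j$, with i.i.d. $\mathcal{CN}(0,1)$ entries and rows $\mathbf h_i$. With $\bar P=\sqrt P$, the estimate of TX $j$ is $\hat{\mathbf H}^{(j)}=\sqrt{1-(z^{(j)})^2}\,\mathbf H+z^{(j)}\boldsymbol\Delta^{(j)}$, $z^{(j)}=\bar P^{-\alpha^{(j)}}$, where $\boldsymbol\Delta^{(j)}$ has i.i.d. $\mathcal{CN}(0,1)$ entries and is independent of $\mathbf H$, and $1\ge\alpha^{(1)}>\dots>\alpha^{(M)}>0$. In the Hierarchical CSIT setting, TX $j$ knows $\hat{\mathbf H}^{(j)},\hat{\mathbf H}^{(j+1)},\dots,\hat{\mathbf H}^{(M)}$. Assume $N_1\ge K-1$. A precoder $\mathbf T=[\mathbf t_1,\dots,\mathbf t_K]\in\mathbb C^{N_T\times K}$ must have all its rows (one per antenna) of Euclidean norm at most $1$. Its expected sum rate is $$\sum_{i=1}^K\mathbb E\Big[\log_2\Big(1+\frac{P|\mathbf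 h_i\mathbf t_i|^2}{1+\sum_{\ell\ne i}P|\mathbf h_i\mathbf t_\ell|^2}\Big)\Big].$$ **Centralized scheme.** Let $\mathcal V:\mathbb C^{K\times N_T}\to\mathbb C^{N_T\times K}$, $\mathcal V(\hat{\mathbf H})=[\mathbf v_1,\dots,\mathbf v_K]$, be a function obtained from $\hat{\mathbf H}$ and constant matrices by finitely many sums, products, conjugate transposes, norms and generalized inverses, which always satisfies the per-antenna power constraint and is such that, for $\hat{\mathbf H}$ with rows $\hat{\mathbf h}_i$ and i.i.d. $\mathcal{CN}(0,1)$ entries: almost surely $\hat{\mathbf h}_i\mathbf v_\ell=0$ for all $\ell\ne i$ and $\hat{\mathbf h}_i\mathbf v_i\neq 0$ for all $i$; $\mathbb E[|v|^{-1}]<\infty$ for every entry $v$ of $\mathcal V(\hat{\mathbf H})$; and every $\|\mathbf v_i\|$ has a bounded probability density. Let $R^\star(\alpha^{(1)})$ be the expected sum rate of the precoder $\mathcal V(\hat{\mathbf H}^{(1)})$ (all TXs know $\hat{\mathbf H}^{(1)}$). **Decentralized scheme (CD-ZF under Hierarchical CSIT).** Let $0<\alpha_\mu<\alpha^{(M)}$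 and let $\mu=\mu(P)\in(0,1)$ satisfy $1-\mu=\Theta(\bar P^{-\alpha_\mu})$ as $P\to\infty$. TX $j\ge 2$ computes the rows $\mu\,\mathbf w_{\ell,j}$ ($1\le\ell\le K$), where $\mathbf w_{\ell,j}$ is the block, at the antennas of TX $j$, of column $\ell$ of $\mathcal V(\hat{\mathbf H}^{(j)})$. TX $1$ recomputes the $\mathbf w_{\ell,j}$, $j\ge2$, from the CSI available to it and computes $\mu\,\mathbf w_{\ell,1}$ with $$\mathbf w_{\ell,1}=\mathbf v_{\ell,1}+\hat{\mathbf H}_{\bar\ell,1}^{\dagger}\,\hat{\mathbf H}_{\bar\ell,\bar1}\,(\mathbf v_{\ell,\bar1}-\mathbf w_{\ell,\bar1}).$$ Here $[\mathbf v_1,\dots,\mathbf v_K]=\mathcal V(\hat{\mathbf H}^{(1)})$; $\hat{\mathbf H}_{\bar\ell,1}$ and $\hat{\mathbf H}_{\bar\ell,\bar1}$ are $\hat{\mathbf H}^{(1)}$ without its $\ell$-th row, restricted to the antennas of TX $1$ and of the other TXs respectively; the blocks of vectors are denoted accordingly; and $\dagger$ is the Moore–Penrose inverse. A TX is in power outage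 if a row that it computes has norm greater than $1$; it then transmits instead with an arbitrary (measurable) precoder that depends on its CSI and satisfies the power constraint. Let $R(\boldsymbol\alpha_M)$ be the expected sum rate of the resulting precoder. **Claim.** For every such $\mathcal V$, $\mu$ and choice of precoders in outage: 1. the resulting precoder always satisfies the per-antenna power constraint, and all the instantaneous rates of both schemes are integrable for $P\ge1$; 2. consistency holds with probability one for every $P\ge 1$: the precoders that TX $1$ computes for TXs $2,\dots,M$ are those that these TXs apply; 3. the probability that some TX is in power outage is $o(1/\log_2 P)$ as $P\to\infty$; 4. the centralized rate is asymptotically achieved: $\displaystyle\lim_{P\to\infty}\big(R^\star(\alpha^{(1)})-R(\boldsymbol\alpha_M)\big)=0$. -/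

import Mathlib

open MeasureTheory ProbabilityTheory Filter Asymptotics
open scoped ENNReal NNReal Matrix

namespace NetworkMISO

/-! ### Moore-Penrose inverses -/

/-- `B` satisfies the four Penrose equations for the complex matrix `A`. -/
structure IsMoorePenrose {m n : Type*} [Fintype m] [Fintype n]
    (A : Matrix m n ℂ) (B : Matrix n m ℂ) : Prop where
  mul_mul_self : A * B * A = A
  mul_mul_inv : B * A * B = B
  left_herm : (A * B)ᴴ = A * B
  right_herm : (B * A)ᴴ = B * A

theorem IsMoorePenrose.unique {m n : Type*} [Fintype m] [Fintype n]
    {A : Matrix m n ℂ} {B C : Matrix n m ℂ}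
    (hB : IsMoorePenrose A B) (hC : IsMoorePenrose A C) : B = C := by
  have h1 : A * B = A * C := by
    calc A * B = (A * B)ᴴ := hB.left_herm.symm
      _ = (A * C * A * B)ᴴ := by rw [hC.mul_mul_self]
      _ = (A * B)ᴴ * (A * C)ᴴ := by rw [Matrix.mul_assoc (A * C), Matrix.conjTranspose_mul]
      _ = A * B * A * C := by rw [hB.left_herm, hC.left_herm, ← Matrix.mul_assoc]
      _ = A * C := by rw [hB.mul_mul_self]
  have h2 : B * A = C * A := by
    calc B * A = (B * A)ᴴ := hB.right_herm.symm
      _ = (B * (A * C * A))ᴴ := by rw [hC.mul_mul_self]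
      _ = (C * A)ᴴ * (B * A)ᴴ := by
        rw [← Matrix.conjTranspose_mul]; simp only [Matrix.mul_assoc]
      _ = C * (A * B * A) := by rw [hB.right_herm, hC.right_herm]; simp only [Matrix.mul_assoc]
      _ = C * A := by rw [hB.mul_mul_self]
  calc B = B * A * B := hB.mul_mul_inv.symm
    _ = C * (A * B) := by rw [h2, Matrix.mul_assoc]
    _ = C := by rw [h1, ← Matrix.mul_assoc, hC.mul_mul_inv]

open ComplexOrder in
theorem exists_isMoorePenrose {m n : Type*} [Fintype m] [Fintype n] (A : Matrix m n ℂ) :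
    ∃ B : Matrix n m ℂ, IsMoorePenrose A B := by
  classical
  set S : Matrix n n ℂ := Aᴴ * A with hS
  have hSh : S.IsHermitian := Matrix.isHermitian_conjTranspose_mul_self A
  set U : Matrix n n ℂ := (hSh.eigenvectorUnitary : Matrix n n ℂ) with hU
  set d : n → ℂ := fun i => (hSh.eigenvalues i : ℂ) with hd
  have hUU : Uᴴ * U = 1 := by
    have := (Matrix.mem_unitaryGroup_iff' (A := U)).1 hSh.eigenvectorUnitary.2
    simpa [Matrix.star_eq_conjTranspose] using this
  have hspec : S = U * Matrix.diagonal d * Uᴴ := by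
    have := hSh.spectral_theorem
    rw [Unitary.conjStarAlgAut_apply] at this
    simpa [Matrix.star_eq_conjTranspose, hU, hd, Function.comp_def] using this
  set T : Matrix n n ℂ := U * Matrix.diagonal (fun i => (d i)⁻¹) * Uᴴ with hT
  have cancel : ∀ X Y : Matrix n n ℂ, U * X * Uᴴ * (U * Y * Uᴴ) = U * (X * Y) * Uᴴ := by
    intro X Y
    calc U * X * Uᴴ * (U * Y * Uᴴ) = U * X * (Uᴴ * U) * Y * Uᴴ := by
          simp only [Matrix.mul_assoc]
      _ = U * (X * Y) * Uᴴ := by rw [hUU]; simp only [Matrix.mul_assoc, Matrix.one_mul]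
  have hdr : ∀ i, star (d i) = d i := fun i => by simp [hd]
  have hTh : Tᴴ = T := by
    simp only [hT, Matrix.conjTranspose_mul, Matrix.conjTranspose_conjTranspose,
      Matrix.diagonal_conjTranspose, Matrix.mul_assoc]
    congr 3
    funext i
    simp only [Pi.star_apply, star_inv₀, hdr]
  have hTST : T * S * T = T := by
    rw [hspec, hT, cancel, cancel]
    simp only [Matrix.diagonal_mul_diagonal]
    congr 3
    funext i
    by_cases h : d i = 0 <;> simp [h]
  have hSTS : S * T * S = S := by
    rw [hT, hspec, cancel, cancel]
    simp only [Matrix.diagonal_mul_diagonal]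
    congr 3
    funext i
    by_cases h : d i = 0 <;> simp [h]
  have hcomm : S * T = T * S := by
    rw [hT, hspec, cancel, cancel]
    simp only [Matrix.diagonal_mul_diagonal, mul_comm]
  have hATS : A * T * S = A := by
    have key : (A * T * S - A)ᴴ * (A * T * S - A) = 0 := by
      have e1 : (A * T * S - A)ᴴ = S * T * Aᴴ - Aᴴ := by
        rw [Matrix.conjTranspose_sub, Matrix.conjTranspose_mul (A * T) S,
          Matrix.conjTranspose_mul A T, hTh, hSh.eq, ← Matrix.mul_assoc]
      rw [e1]
      have e2 : (S * T * Aᴴ - Aᴴ) * (A * T * S - A)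
          = (S * T * S) * T * S - S * T * S - S * T * S + S := by
        simp only [Matrix.sub_mul, Matrix.mul_sub, hS, Matrix.mul_assoc]
        abel
      rw [e2, hSTS, hSTS]
      abel
    have := Matrix.conjTranspose_mul_self_eq_zero.1 key
    exact sub_eq_zero.1 this
  refine ⟨T * Aᴴ, ?_, ?_, ?_, ?_⟩
  · rw [← Matrix.mul_assoc, Matrix.mul_assoc (A * T), ← hS, hATS]
  · calc T * Aᴴ * A * (T * Aᴴ) = T * S * T * Aᴴ := by simp only [hS, Matrix.mul_assoc]
      _ = T * Aᴴ := by rw [hTST]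
  · simp only [Matrix.conjTranspose_mul, Matrix.conjTranspose_conjTranspose, hTh,
      Matrix.mul_assoc]
  · rw [Matrix.mul_assoc, ← hS, Matrix.conjTranspose_mul, hTh, hSh.eq, hcomm]

/-- The Moore-Penrose inverse of a complex matrix. -/
noncomputable def pinv {m n : Type*} [Fintype m] [Fintype n] (A : Matrix m n ℂ) :
    Matrix n m ℂ :=
  (exists_isMoorePenrose A).choose

theorem pinv_spec {m n : Type*} [Fintype m] [Fintype n] (A : Matrix m n ℂ) :
    IsMoorePenrose A (pinv A) :=
  (exists_isMoorePenrose A).choose_spec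

/-- The Frobenius norm of a complex matrix. -/
noncomputable def frobNorm {m n : Type*} [Fintype m] [Fintype n] (A : Matrix m n ℂ) : ℝ :=
  √(∑ i, ∑ j, ‖A i j‖ ^ 2)

/-! ### Antennas, channels and precoders -/

/-- The transmit antennas: antenna `⟨j, n⟩` is the `n`-th antenna of TX `j`.
The best-informed TX is TX `0`. -/
abbrev Ant {M : ℕ} (N : Fin M → ℕ) : Type := Σ j : Fin M, Fin (N j)

/-- Channel matrices (and channel estimates) from all transmit antennas to the `K` RXs. -/
abbrev Channel (K : ℕ) {M : ℕ} (N : Fin M → ℕ) : Type := Matrix (Fin K) (Ant N) ℂ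

/-- Global precoding matrices; column `ℓ` carries the symbol of RX `ℓ`. -/
abbrev Precoder {M : ℕ} (N : Fin M → ℕ) (K : ℕ) : Type := Matrix (Ant N) (Fin K) ℂ

/-- The precoding matrix applied at a single TX with `n` antennas. -/
abbrev TXPrecoder (n K : ℕ) : Type := Matrix (Fin n) (Fin K) ℂ

/-- The Euclidean norm of the `a`-th row of a matrix: the quantity constrained by the
per-antenna instantaneous power constraint. -/
noncomputable def rowNorm {ι : Type*} {K : ℕ} (T : Matrix ι (Fin K) ℂ) (a : ι) : ℝ :=
  √(∑ i, ‖T a i‖ ^ 2)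

/-! ### Gaussian model -/

/-- Matrices carry the product (that is, entrywise) measurable structure. -/
noncomputable instance instMeasurableSpaceMatrix {m n : Type*} : MeasurableSpace (Matrix m n ℂ) :=
  inferInstanceAs (MeasurableSpace (m → n → ℂ))

/-- The circularly-symmetric complex normal distribution `CN(0,1)`. -/
noncomputable def stdComplexNormal : Measure ℂ :=
  ((gaussianReal 0 (1 / 2)).prod (gaussianReal 0 (1 / 2))).map
    Complex.measurableEquivRealProd.symm

/-- The law of a channel matrix with i.i.d. `CN(0,1)` entries. -/
noncomputable def channelLaw (K : ℕ) {M : ℕ} (N : Fin M → ℕ) : Measure (Channel K N) :=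
  Measure.pi fun _ : Fin K => Measure.pi fun _ : Ant N => stdComplexNormal

/-- The channel `H` has i.i.d. `CN(0,1)` entries, and each estimation noise `Δ j` has i.i.d.
`CN(0,1)` entries and is independent of `H`. The joint law of the noises of different TXs is
left arbitrary. -/
structure IsCSITModel {Ω : Type*} [MeasurableSpace Ω] (Pr : Measure Ω) {K M : ℕ}
    {N : Fin M → ℕ} (H : Ω → Channel K N) (Δ : Fin M → Ω → Channel K N) : Prop where
  channel : HasLaw H (channelLaw K N) Pr
  noise : ∀ j, HasLaw (Δ j) (channelLaw K N) Pr
  indep : ∀ j, IndepFun H (Δ j) Pr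

/-- The estimate `√(1 - z²) H + z Δ` with `z = (√P) ^ (-a)`, where `P` is the SNR and `a` the
accuracy exponent. -/
noncomputable def estimate {K M : ℕ} {N : Fin M → ℕ} (P a : ℝ) (H Δ : Channel K N) :
    Channel K N :=
  ((√(1 - (√P ^ (-a)) ^ 2) : ℝ) : ℂ) • H + ((√P ^ (-a) : ℝ) : ℂ) • Δ

/-! ### Centralized zero-forcing schemes -/

/-- Matrix-valued functions of the channel estimate that are combinations of sums, products,
conjugate transposes, norms and generalized inverses of the estimate and of constant matrices.
A scalar is a `1 × 1` matrix, so division by a scalar is an instance of `ginv`; extraction and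
assembly of blocks are products with constant `0`-`1` matrices. Every other generalized inverse
`A† + U - A† A U A A†` of `A` is obtained from the Moore-Penrose one. -/
inductive IsAlgebraicMap {κ τ : Type} :
    ∀ {m n : Type}, (Matrix κ τ ℂ → Matrix m n ℂ) → Prop
  | channel : IsAlgebraicMap fun G => G
  | const {m n : Type} (C : Matrix m n ℂ) : IsAlgebraicMap fun _ => C
  | add {m n : Type} {f g : Matrix κ τ ℂ → Matrix m n ℂ} :
      IsAlgebraicMap f → IsAlgebraicMap g → IsAlgebraicMap fun G => f G + g G
  | mul {l m n : Type} [Fintype m] {f : Matrix κ τ ℂ → Matrix l m ℂ}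
      {g : Matrix κ τ ℂ → Matrix m n ℂ} :
      IsAlgebraicMap f → IsAlgebraicMap g → IsAlgebraicMap fun G => f G * g G
  | conjTranspose {m n : Type} {f : Matrix κ τ ℂ → Matrix m n ℂ} :
      IsAlgebraicMap f → IsAlgebraicMap fun G => (f G)ᴴ
  | norm {m n : Type} [Fintype m] [Fintype n] {f : Matrix κ τ ℂ → Matrix m n ℂ} :
      IsAlgebraicMap f →
        IsAlgebraicMap fun G => (Matrix.of fun _ _ : Unit => ((frobNorm (f G) : ℝ) : ℂ))
  | ginv {m n : Type} [Fintype m] [Fintype n] {f : Matrix κ τ ℂ → Matrix m n ℂ} :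
      IsAlgebraicMap f → IsAlgebraicMap fun G => pinv (f G)

/-- A centralized zero-forcing scheme `V`, mapping a channel estimate `G` to the precoder
`V G = [v₁, …, v_K]`. Expectations and densities refer to an estimate with i.i.d. `CN(0,1)`
entries, which is the law of every estimate at every SNR `P ≥ 1`. -/
structure IsZFScheme {K M : ℕ} {N : Fin M → ℕ} (V : Channel K N → Precoder N K) : Prop where
  algebraic : IsAlgebraicMap V
  /-- Per-antenna instantaneous power constraint. -/
  power : ∀ G a, rowNorm (V G) a ≤ 1
  /-- Zero forcing: `ĥ_i v_ℓ = 0` for `ℓ ≠ i`, almost surely. -/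
  zero_forcing : ∀ᵐ G ∂(channelLaw K N), ∀ i ℓ, ℓ ≠ i → (G * V G) i ℓ = 0
  /-- `E[|v_{i,j,n}|⁻¹]` is finite (with `0⁻¹ = ∞`). -/
  inv_moment : ∀ i a, ∫⁻ G, ‖V G a i‖ₑ⁻¹ ∂(channelLaw K N) < ∞
  /-- `‖v_i‖` has a bounded probability density. -/
  density : ∀ i, ∃ C : ℝ≥0,
    (channelLaw K N).map (fun G => √(∑ a, ‖V G a i‖ ^ 2)) ≤ C • (volume : Measure ℝ)

/-! ### Hierarchical CSIT and the consistent decentralized zero-forcing scheme -/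

/-- The CSI available at TX `j` under hierarchical CSIT: its own estimate and the estimates of
all the less accurate TXs. -/
abbrev HierInfo (K : ℕ) {M : ℕ} (N : Fin M → ℕ) (j : Fin M) : Type :=
  {k : Fin M // j ≤ k} → Channel K N

/-- A precoding strategy under hierarchical CSIT: every TX maps the CSI available to it to its
own precoding matrix. -/
abbrev HierStrategy (K : ℕ) {M : ℕ} (N : Fin M → ℕ) : Type :=
  ∀ j : Fin M, HierInfo K N j → TXPrecoder (N j) K

/-- The part of the estimates `G` that is available at TX `j`. -/
def hierInfo {K M : ℕ} {N : Fin M → ℕ} (G : Fin M → Channel K N) (j : Fin M) :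
    HierInfo K N j :=
  fun k => G k

/-- The global precoder that results when all TXs apply a strategy, the estimates being `G`. -/
def HierStrategy.precoder {K M : ℕ} {N : Fin M → ℕ} (S : HierStrategy K N)
    (G : Fin M → Channel K N) : Precoder N K :=
  Matrix.of fun a ℓ => S a.1 (hierInfo G a.1) a.2 ℓ

/-- The rows of the centralized precoder that correspond to the antennas of TX `j`. -/
def naive {K M : ℕ} {N : Fin M → ℕ} (V : Channel K N → Precoder N K) (j : Fin M)
    (G : Channel K N) : TXPrecoder (N j) K :=
  Matrix.of fun n ℓ => V G ⟨j, n⟩ ℓ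

section CDZF

variable {K M : ℕ} [NeZero M] {N : Fin M → ℕ}

/-- What TX `0` computes, from the CSI available to it, as the (unscaled) precoder of TX `j`. -/
def predicted (V : Channel K N → Precoder N K) (I : HierInfo K N 0) (j : Fin M) :
    TXPrecoder (N j) K :=
  naive V j (I ⟨j, Fin.zero_le j⟩)

/-- The estimate `G` with row `ℓ` removed, restricted to the antennas of TX `0`. -/
def ownBlock (G : Channel K N) (ℓ : Fin K) :
    Matrix {i : Fin K // i ≠ ℓ} {a : Ant N // a.1 = 0} ℂ :=
  Matrix.of fun i a => G i a

/-- The estimate `G` with row `ℓ` removed, restricted to the antennas of the other TXs. -/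
def otherBlock (G : Channel K N) (ℓ : Fin K) :
    Matrix {i : Fin K // i ≠ ℓ} {a : Ant N // a.1 ≠ 0} ℂ :=
  Matrix.of fun i a => G i a

/-- The correction term that TX `0` adds to its naive precoder for the symbol of RX `ℓ`: with `G`
the own estimate of TX `0`, the pseudo-inverse of `ownBlock G ℓ` times `otherBlock G ℓ` times the
difference, at the antennas of the other TXs, between the centralized precoder and the predicted
one. -/
noncomputable def correction (V : Channel K N → Precoder N K) (I : HierInfo K N 0)
    (ℓ : Fin K) : {a : Ant N // a.1 = 0} → ℂ :=
  pinv (ownBlock (I ⟨0, le_rfl⟩) ℓ) *ᵥ (otherBlock (I ⟨0, le_rfl⟩) ℓ *ᵥ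
    fun a => V (I ⟨0, le_rfl⟩) a.1 ℓ - predicted V I a.1.1 a.1.2 ℓ)

/-- The precoder `μ w` that TX `j` computes, before the power constraint is checked:
TX `j ≠ 0` naively uses its own estimate, and TX `0` corrects the resulting interference. -/
noncomputable def nominal (V : Channel K N → Precoder N K) (μ : ℝ) : HierStrategy K N :=
  fun j I => Matrix.of fun n ℓ => (μ : ℂ) *
    (naive V j (I ⟨j, le_rfl⟩) n ℓ +
      if h : j = 0 then correction V (fun k => I ⟨k, h ▸ k.2⟩) ℓ ⟨⟨j, n⟩, h⟩ else 0)

/-- TX `j`, with CSI `I`, is in power outage: one of its antennas would violate the power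
constraint. -/
def InOutage (V : Channel K N → Precoder N K) (μ : ℝ) (j : Fin M) (I : HierInfo K N j) : Prop :=
  ∃ n, 1 < rowNorm (nominal V μ j I) n

open Classical in
/-- The consistent decentralized zero-forcing scheme under hierarchical CSIT, with centralized
scheme `V`, power back-off `μ`, and fallback strategy `F` for the TXs in power outage. -/
noncomputable def cdzf (V : Channel K N → Precoder N K) (μ : ℝ) (F : HierStrategy K N) :
    HierStrategy K N :=
  fun j I => if InOutage V μ j I then F j I else nominal V μ j I

end CDZF

/-! ### Rates -/

/-- The instantaneous rate of RX `i`, at SNR `P`, channel `H` and precoder `T`. -/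
noncomputable def instRate {K M : ℕ} {N : Fin M → ℕ} (P : ℝ) (H : Channel K N)
    (T : Precoder N K) (i : Fin K) : ℝ :=
  Real.logb 2 (1 + P * ‖(H * T) i i‖ ^ 2 /
    (1 + ∑ ℓ ∈ Finset.univ.erase i, P * ‖(H * T) i ℓ‖ ^ 2))

/-- The expected sum rate, at SNR `P`, of a random precoder `T` over a random channel `H`. -/
noncomputable def sumRate {Ω : Type*} [MeasurableSpace Ω] (Pr : Measure Ω) {K M : ℕ}
    {N : Fin M → ℕ} (P : ℝ) (H : Ω → Channel K N) (T : Ω → Precoder N K) : ℝ :=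
  ∑ i, ∫ ω, instRate P (H ω) (T ω) i ∂Pr

end NetworkMISO

/-!
The centralized precoder `V` is an algebraic function of the channel estimate, so it is regular
outside a set that has a small probability, quantitatively. This is made precise by the filter
`whp`: an event holds along `whp` if it fails with probability `O(P ^ (-ε))` at SNR `P`, for some
`ε > 0`, which beats every logarithm of `P`.

*Algebraic functions of Gaussian variables.* A nonzero polynomial `Q` of independent Gaussian
variables satisfies `Pr(|Q| < t) ≤ C t ^ ε` (`MvPolynomial.exists_measure_norm_eval_lt_le`). If `f`
is algebraic over the polynomials, then a nonzero value of `f` bounds the constant term of its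
equation; hence `|f|` is either `0` or at least `P ^ (-ε)`, with high probability
(`isAwayFromZero_of_mem_algebraicFun`), and at most `P ^ ε`, as `f⁻¹` is algebraic too. For two
Gaussian processes at distance of order `P ^ (-b)`, the algebraic functions whose values at the two
processes are equally close form an algebra that is closed under conjugation, inversion (with
`0⁻¹ = 0`) and square roots (`isArithClosed_closeFun`): small denominators cost an arbitrarily small
power of `P`, and both denominators vanish simultaneously. The Moore-Penrose inverse is arithmetic
in this sense, by a formula in the coefficients of the characteristic polynomial of the Gram matrix
(`IsArithClosed.pinv_mem`), so all algebraic maps are covered (`IsArithClosed.algebraicMap_mem`).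

*Power outage.* Consequently `V` takes values at distance about `P ^ (-α j / 2)` at the estimates of
TX `0` and TX `j`, and the correction of TX `0` is of this size (`isClose_corrected`). As
`αμ < α j`, it is dominated by the back-off `1 - μ`, which is of order `P ^ (-αμ / 2)`
(`eventually_not_inOutage`).

*Rates.* A rate is a difference of logarithms of the total received power and of the interference,
and a logarithm changes little if its argument changes by a small factor. For the total power this
is so because the useful signal is not tiny. The interference may itself vanish with `P`. The
channel is `H = c Ĝ - z D`, where the estimate `Ĝ` of TX `0` and the matrix `D` are independent by
rotation invariance (`measurePreserving_rotate_channelLaw`). Both precoders zero-force `Ĝ`, the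
decentralized one thanks to the correction (`mul_corrected_sub_eq_zero`), so both interferences
carry the same factor `z`, which cancels in the comparison, and their cofactors `D v` are not tiny
(`IsZFScheme.eventually_le_norm_complement`). On the exceptional event the rates are at most
`log₂ (1 + P)` plus an integrable variable (`tendsto_integral_zero_of_whp`).
-/

namespace NetworkMISO

/-! ### Small-ball estimates for polynomials of random variables with bounded densities -/

/-- If every root of a polynomial of degree `d` and leading coefficient `a` is at distance at least
`s`, its value is at least `|a| s ^ d`; so small values occur only near the roots. -/
theorem Polynomial.measure_norm_eval_lt_le {ν : Measure ℝ} {C : ℝ≥0}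
    (hν : ν ≤ C • (volume : Measure ℝ)) (q : Polynomial ℂ) {s : ℝ} (hs : 0 ≤ s) :
    ν {y : ℝ | ‖q.eval (y : ℂ)‖ < ‖q.leadingCoeff‖ * s ^ q.natDegree}
      ≤ ENNReal.ofReal (q.natDegree * (C * (2 * s))) := by
  classical
  have hsub : {y : ℝ | ‖q.eval (y : ℂ)‖ < ‖q.leadingCoeff‖ * s ^ q.natDegree}
      ⊆ ⋃ r ∈ q.roots.toFinset, Metric.ball r.re s := by
    intro y hy
    by_contra hcon
    simp only [Set.mem_iUnion, Multiset.mem_toFinset, Metric.mem_ball, exists_prop, not_exists,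
      not_and, not_lt] at hcon
    have hsp : q.Splits := IsAlgClosed.splits q
    have hev : q.eval (y : ℂ) = q.leadingCoeff * (q.roots.map fun r => (y : ℂ) - r).prod := by
      conv_lhs => rw [hsp.eq_prod_roots]
      simp [Polynomial.eval_multiset_prod, Multiset.map_map]
    have hprod : s ^ q.natDegree ≤ ‖(q.roots.map fun r => (y : ℂ) - r).prod‖ := by
      rw [← Polynomial.splits_iff_card_roots.1 hsp]
      have : ∀ m : Multiset ℂ, (∀ r ∈ m, s ≤ dist y r.re) →
          s ^ m.card ≤ ‖(m.map fun r => (y : ℂ) - r).prod‖ := by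
        intro m
        induction m using Multiset.induction_on with
        | empty => simp
        | cons a m ih =>
          intro h
          have h1 := ih fun r hr => h r (Multiset.mem_cons_of_mem hr)
          have h2 : s ≤ ‖(y : ℂ) - a‖ := by
            refine (h a (Multiset.mem_cons_self _ _)).trans ?_
            rw [Real.dist_eq]
            simpa using Complex.abs_re_le_norm ((y : ℂ) - a)
          simp only [Multiset.card_cons, Multiset.map_cons, Multiset.prod_cons, norm_mul, pow_succ']
          exact mul_le_mul h2 h1 (pow_nonneg hs _) (norm_nonneg _)
      exact this _ hcon
    rw [Set.mem_ofPred_eq, hev, norm_mul] at hy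
    exact absurd hy (not_lt.2 (mul_le_mul_of_nonneg_left hprod (norm_nonneg _)))
  refine (measure_mono hsub).trans ((measure_biUnion_finset_le _ _).trans ?_)
  have h1 : ∀ r ∈ q.roots.toFinset, ν (Metric.ball r.re s) ≤ ENNReal.ofReal (C * (2 * s)) := by
    intro r _
    refine (hν _).trans ?_
    rw [Measure.smul_apply, Real.volume_ball, ENNReal.ofReal_mul (p := (C : ℝ)) (by positivity),
      ENNReal.ofReal_coe_nnreal, ENNReal.smul_def, smul_eq_mul]
  refine (Finset.sum_le_card_nsmul _ _ _ h1).trans ?_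
  rw [nsmul_eq_mul, ENNReal.ofReal_mul (p := (q.natDegree : ℝ)) (by positivity),
    ENNReal.ofReal_natCast]
  gcongr
  exact (Multiset.toFinset_card_le _).trans (Polynomial.card_roots' q)

/-- A nonzero polynomial in independent random variables with bounded densities is smaller than `t`
with probability at most a constant times a power of `t`. By induction on the number of variables:
either the leading coefficient with respect to the first variable is small, or the value is small
for a polynomial in one variable whose leading coefficient is not. -/
theorem MvPolynomial.exists_measure_norm_eval_lt_le_fin {ν : Measure ℝ} [IsProbabilityMeasure ν]
    {C : ℝ≥0} (hν : ν ≤ C • (volume : Measure ℝ)) :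
    ∀ {n : ℕ} {p : MvPolynomial (Fin n) ℂ}, p ≠ 0 →
      ∃ ε > 0, ∃ D : ℝ, 0 < D ∧ ∀ t : ℝ, 0 < t → t ≤ 1 →
        Measure.pi (fun _ : Fin n => ν) {x | ‖MvPolynomial.eval (fun i => (x i : ℂ)) p‖ < t}
          ≤ ENNReal.ofReal (D * t ^ (ε : ℝ)) := by
  intro n
  induction n with
  | zero =>
    intro p hp
    obtain ⟨a, rfl⟩ := MvPolynomial.C_surjective (Fin 0) p
    have ha : a ≠ 0 := by rintro rfl; simp at hp
    refine ⟨1, one_pos, ‖a‖⁻¹, by positivity, fun t ht _ => ?_⟩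
    by_cases h : ‖a‖ < t
    · refine prob_le_one.trans ?_
      rw [← ENNReal.ofReal_one]
      refine ENNReal.ofReal_le_ofReal ?_
      rw [Real.rpow_one, inv_mul_eq_div, one_le_div (by positivity)]
      exact h.le
    · simp [h]
  | succ n ih =>
    intro p hp
    set q := MvPolynomial.finSuccEquiv ℂ n p with hq
    have hq0 : q ≠ 0 := by simpa [hq] using hp
    set a := q.leadingCoeff with ha
    set d := q.natDegree with hd
    have ha0 : a ≠ 0 := by simpa [ha] using hq0
    obtain ⟨ε, hε, D, hD, hb⟩ := ih ha0
    set δ : ℝ := 1 / (2 * (d + 1)) with hδ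
    have hδ0 : 0 < δ := by positivity
    refine ⟨min (ε / 2) δ, by positivity, D + d * (C * 2) , by positivity, fun t ht ht1 => ?_⟩
    -- the exponent is chosen for `s ^ (d + 1) = √t`, which covers the degree `d = 0` as well
    set s : ℝ := t ^ δ with hs
    have hs0 : 0 ≤ s := by positivity
    have hs1 : s ≤ 1 := Real.rpow_le_one ht.le ht1 hδ0.le
    have hsd : √t ≤ s ^ d := by
      have : √t = s ^ (d + 1) := by
        rw [hs, ← Real.rpow_natCast, ← Real.rpow_mul ht.le, Real.sqrt_eq_rpow]
        congr 1
        rw [hδ]; push_cast; field_simp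
      rw [this]
      exact pow_le_pow_of_le_one hs0 hs1 (Nat.le_succ d)
    let ev : ℝ → (Fin n → ℝ) → ℂ := fun y x =>
      ((q.map (MvPolynomial.eval fun i => (x i : ℂ))).eval (y : ℂ))
    let av : (Fin n → ℝ) → ℂ := fun x => MvPolynomial.eval (fun i => (x i : ℂ)) a
    have hmp := (measurePreserving_piFinSuccAbove (fun _ : Fin (n + 1) => ν) 0)
    have heval : ∀ x : Fin (n + 1) → ℝ, MvPolynomial.eval (fun i => (x i : ℂ)) p
        = ev (x 0) (Fin.tail x) := by
      intro x
      have := MvPolynomial.eval_eq_eval_mv_eval' (fun i => ((Fin.tail x i : ℝ) : ℂ)) (x 0 : ℂ) p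
      rw [← hq] at this
      refine Eq.trans ?_ this
      congr 2
      funext i
      refine Fin.cases ?_ (fun j => ?_) i <;> simp [Fin.tail]
    have hcont : Continuous fun z : ℝ × (Fin n → ℝ) => ev z.1 z.2 := by
      have : (fun z : ℝ × (Fin n → ℝ) => ev z.1 z.2)
          = fun z => MvPolynomial.eval (fun i => ((Fin.cons z.1 z.2 : Fin (n+1) → ℝ) i : ℂ)) p := by
        funext z
        rw [heval]
        simp
      rw [this]
      refine (MvPolynomial.continuous_eval p).comp ?_
      refine continuous_pi fun i => Complex.continuous_ofReal.comp ?_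
      refine Fin.cases ?_ (fun j => ?_) i
      · simpa using continuous_fst
      · simpa [Function.comp_def] using
          (continuous_apply j).comp (continuous_snd (X := ℝ) (Y := Fin n → ℝ))
    have hcontA : Continuous av :=
      (MvPolynomial.continuous_eval a).comp
        (continuous_pi fun i => Complex.continuous_ofReal.comp (continuous_apply i))
    -- `A`: the leading coefficient is below `√t`; `B`: it is not, but the polynomial is below `t`
    let A : Set (ℝ × (Fin n → ℝ)) := Set.univ ×ˢ {x | ‖av x‖ < √t}
    let B : Set (ℝ × (Fin n → ℝ)) := {z | √t ≤ ‖av z.2‖ ∧ ‖ev z.1 z.2‖ < t}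
    have hBm : MeasurableSet B :=
      (measurableSet_le measurable_const (hcontA.norm.measurable.comp measurable_snd)).inter
        (measurableSet_lt hcont.norm.measurable measurable_const)
    have hset : {x : Fin (n + 1) → ℝ | ‖MvPolynomial.eval (fun i => (x i : ℂ)) p‖ < t}
        ⊆ (MeasurableEquiv.piFinSuccAbove (fun _ : Fin (n + 1) => ℝ) 0) ⁻¹' (A ∪ B) := by
      intro x hx
      rw [Set.mem_ofPred_eq, heval] at hx
      have : (MeasurableEquiv.piFinSuccAbove (fun _ : Fin (n + 1) => ℝ) 0) x
          = (x 0, Fin.tail x) := rfl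
      rw [Set.mem_preimage, this]
      by_cases h : ‖av (Fin.tail x)‖ < √t
      · exact Or.inl ⟨trivial, h⟩
      · exact Or.inr ⟨not_lt.1 h, hx⟩
    have hA : (ν.prod (Measure.pi fun _ : Fin n => ν)) A ≤ ENNReal.ofReal (D * √t ^ ε) := by
      rw [Measure.prod_prod, measure_univ, one_mul]
      exact hb _ (Real.sqrt_pos.2 ht) (Real.sqrt_le_one.2 ht1)
    have hB : (ν.prod (Measure.pi fun _ : Fin n => ν)) B
        ≤ ENNReal.ofReal (d * (C * (2 * s))) := by
      rw [Measure.prod_apply_symm hBm]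
      refine (lintegral_mono (g := fun _ => ENNReal.ofReal (d * (C * (2 * s)))) fun x => ?_).trans
        (by simp)
      by_cases hx : √t ≤ ‖av x‖
      · have hax : av x ≠ 0 := by
          intro h0
          rw [h0, norm_zero] at hx
          exact absurd hx (not_le.2 (Real.sqrt_pos.2 ht))
        have hdeg : (q.map (MvPolynomial.eval fun i => (x i : ℂ))).natDegree = d :=
          Polynomial.natDegree_map_of_leadingCoeff_ne_zero _ hax
        have hlead : (q.map (MvPolynomial.eval fun i => (x i : ℂ))).leadingCoeff = av x :=
          Polynomial.leadingCoeff_map_of_leadingCoeff_ne_zero _ hax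
        have h1 := Polynomial.measure_norm_eval_lt_le hν
          (q.map (MvPolynomial.eval fun i => (x i : ℂ))) hs0
        rw [hdeg, hlead] at h1
        refine le_trans (measure_mono ?_) h1
        intro y hy
        refine lt_of_lt_of_le hy.2 ?_
        calc t = √t * √t := (Real.mul_self_sqrt ht.le).symm
          _ ≤ ‖av x‖ * s ^ d := mul_le_mul hx hsd (Real.sqrt_nonneg _) (norm_nonneg _)
      · have : (fun y => (y, x)) ⁻¹' B = ∅ := by
          ext y; simp only [B, Set.mem_preimage, Set.mem_ofPred_eq, hx, false_and,
            Set.mem_empty_iff_false]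
        rw [this]; simp
    refine (measure_mono hset).trans ?_
    rw [hmp.measure_preimage_equiv]
    refine (measure_union_le _ _).trans ((add_le_add hA hB).trans ?_)
    rw [← ENNReal.ofReal_add (by positivity) (by positivity)]
    refine ENNReal.ofReal_le_ofReal ?_
    have e1 : √t ^ ε ≤ t ^ min (ε / 2) δ := by
      rw [Real.sqrt_eq_rpow, ← Real.rpow_mul ht.le]
      refine Real.rpow_le_rpow_of_exponent_ge ht ht1 ((min_le_left _ _).trans (by linarith))
    have e2 : s ≤ t ^ min (ε / 2) δ :=
      Real.rpow_le_rpow_of_exponent_ge ht ht1 (min_le_right _ _)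
    calc D * √t ^ ε + d * (C * (2 * s))
        ≤ D * t ^ min (ε / 2) δ + d * (C * (2 * t ^ min (ε / 2) δ)) := by gcongr
      _ = _ := by ring

theorem MvPolynomial.exists_measure_norm_eval_lt_le {ν : Measure ℝ} [IsProbabilityMeasure ν]
    {C : ℝ≥0} (hν : ν ≤ C • (volume : Measure ℝ)) {σ : Type*} [Fintype σ]
    {p : MvPolynomial σ ℂ} (hp : p ≠ 0) :
      ∃ ε > 0, ∃ D : ℝ, 0 < D ∧ ∀ t : ℝ, 0 < t → t ≤ 1 →
        Measure.pi (fun _ : σ => ν) {x | ‖MvPolynomial.eval (fun i => (x i : ℂ)) p‖ < t}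
          ≤ ENNReal.ofReal (D * t ^ (ε : ℝ)) := by
  let e := Fintype.equivFin σ
  have hp' : MvPolynomial.rename e p ≠ 0 := by
    rwa [Ne, map_eq_zero_iff _ (MvPolynomial.rename_injective _ e.injective)]
  obtain ⟨ε, hε, D, hD, h⟩ := MvPolynomial.exists_measure_norm_eval_lt_le_fin hν hp'
  refine ⟨ε, hε, D, hD, fun t ht ht1 => le_of_eq_of_le ?_ (h t ht ht1)⟩
  have hmp := measurePreserving_piCongrLeft (fun _ : Fin (Fintype.card σ) => ν) e
  rw [← hmp.measure_preimage_equiv]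
  congr 1
  ext x
  simp only [Set.mem_ofPred_eq, Set.mem_preimage, MvPolynomial.eval_rename]
  have : (fun i => (x i : ℂ)) = (fun i => (((MeasurableEquiv.piCongrLeft
      (fun _ : Fin (Fintype.card σ) => ℝ) e) x i : ℝ) : ℂ)) ∘ e := by
    funext i
    simp only [Function.comp]
    congr 1
    exact (MeasurableEquiv.piCongrLeft_apply_apply (β := fun _ : Fin (Fintype.card σ) => ℝ)
      e x i).symm
  rw [this]

theorem gaussianReal_half_le_volume :
    ∃ C : ℝ≥0, gaussianReal 0 (1 / 2) ≤ C • (volume : Measure ℝ) := by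
  refine ⟨Real.toNNReal (√(2 * Real.pi * ((1 / 2 : ℝ≥0) : ℝ)))⁻¹, ?_⟩
  rw [gaussianReal_of_var_ne_zero _ (by norm_num), ENNReal.smul_def, ← withDensity_const]
  refine withDensity_mono (ae_of_all _ fun x => ?_)
  rw [gaussianPDF, gaussianPDFReal]
  refine ENNReal.ofReal_le_ofReal ?_
  refine mul_le_of_le_one_right (by positivity) (Real.exp_le_one_iff.2 ?_)
  exact div_nonpos_of_nonpos_of_nonneg (by nlinarith [sq_nonneg (x - 0)]) (by positivity)

/-! ### Matrix entries obtained by arithmetic operations -/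

/-- A subalgebra of complex-valued functions that is also closed under conjugation, pointwise
inversion (with `0⁻¹ = 0`) and square roots of nonnegative functions. -/
structure IsArithClosed {X : Type*} (S : Subalgebra ℂ (X → ℂ)) : Prop where
  star_mem : ∀ {f}, f ∈ S → star f ∈ S
  inv_mem : ∀ {f}, f ∈ S → f⁻¹ ∈ S
  sqrt_mem : ∀ {f : X → ℝ}, (∀ x, 0 ≤ f x) → (fun x => (f x : ℂ)) ∈ S →
    (fun x => ((√(f x) : ℝ) : ℂ)) ∈ S

section Pinv

variable {n : Type*} [Fintype n]

open ComplexOrder in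
/-- A generalized inverse `T` of the Gram matrix `Aᴴ * A` yields the Moore-Penrose inverse
`T * Aᴴ` of `A`. -/
theorem isMoorePenrose_of_gram {m : Type*} [Fintype m] {A : Matrix m n ℂ} {T : Matrix n n ℂ}
    (hTh : Tᴴ = T) (hTST : T * (Aᴴ * A) * T = T) (hSTS : (Aᴴ * A) * T * (Aᴴ * A) = Aᴴ * A)
    (hcomm : (Aᴴ * A) * T = T * (Aᴴ * A)) : IsMoorePenrose A (T * Aᴴ) := by
  set S : Matrix n n ℂ := Aᴴ * A with hS
  have hSh : Sᴴ = S := by simp [hS]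
  have hATS : A * T * S = A := by
    have key : (A * T * S - A)ᴴ * (A * T * S - A) = 0 := by
      have e1 : (A * T * S - A)ᴴ = S * T * Aᴴ - Aᴴ := by
        rw [Matrix.conjTranspose_sub, Matrix.conjTranspose_mul (A * T) S,
          Matrix.conjTranspose_mul A T, hTh, hSh, ← Matrix.mul_assoc]
      rw [e1]
      have e2 : (S * T * Aᴴ - Aᴴ) * (A * T * S - A)
          = (S * T * S) * T * S - S * T * S - S * T * S + S := by
        simp only [Matrix.sub_mul, Matrix.mul_sub, hS, Matrix.mul_assoc]
        abel
      rw [e2, hSTS, hSTS]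
      abel
    exact sub_eq_zero.1 (Matrix.conjTranspose_mul_self_eq_zero.1 key)
  refine ⟨?_, ?_, ?_, ?_⟩
  · rw [← Matrix.mul_assoc, Matrix.mul_assoc (A * T), ← hS, hATS]
  · calc T * Aᴴ * A * (T * Aᴴ) = T * S * T * Aᴴ := by simp only [hS, Matrix.mul_assoc]
      _ = T * Aᴴ := by rw [hTST]
  · simp only [Matrix.conjTranspose_mul, Matrix.conjTranspose_conjTranspose, hTh,
      Matrix.mul_assoc]
  · rw [Matrix.mul_assoc, ← hS, Matrix.conjTranspose_mul, hTh, hSh, hcomm]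

variable [DecidableEq n]

/-- The inverse of a Hermitian matrix `S` on its range, provided that `0` is a root of
multiplicity `r` of the characteristic polynomial. -/
noncomputable def charpolyInv (S : Matrix n n ℂ) (r : ℕ) : Matrix n n ℂ :=
  (-(S.charpoly.coeff r)⁻¹) •
    ∑ k ∈ Finset.range (Fintype.card n + 1), S.charpoly.coeff (k + 1 + r) • S ^ k

open ComplexOrder in
theorem _root_.Matrix.IsHermitian.mul_eq_zero_of_pow_mul_eq_zero {S : Matrix n n ℂ}
    (hS : S.IsHermitian) (r : ℕ) {Y : Matrix n n ℂ} (h : S ^ r * Y = 0) : S * Y = 0 := by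
  induction r with
  | zero => simp_all
  | succ r ih =>
    cases r with
    | zero => simpa using h
    | succ r =>
      refine ih ?_
      have : (S ^ (r + 1) * Y)ᴴ * (S ^ (r + 1) * Y) = 0 := by
        have e : (S ^ (r + 1) * Y)ᴴ = (S ^ r * Y)ᴴ * S := by
          rw [pow_succ', Matrix.mul_assoc, Matrix.conjTranspose_mul, hS.eq]
        rw [e, Matrix.mul_assoc, ← Matrix.mul_assoc S, ← pow_succ', h, Matrix.mul_zero]
      exact Matrix.conjTranspose_mul_self_eq_zero.1 this

theorem _root_.Matrix.IsHermitian.star_charpoly_coeff {S : Matrix n n ℂ}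
    (hS : S.IsHermitian) (k : ℕ) : star (S.charpoly.coeff k) = S.charpoly.coeff k := by
  have h1 : S.map (starRingEnd ℂ) = Sᵀ := by
    conv_rhs => rw [← hS.eq]
    ext i j; simp
  have h2 := congrArg (fun p => Polynomial.coeff p k) (Matrix.charpoly_map S (starRingEnd ℂ))
  simp only [Polynomial.coeff_map, h1, Matrix.charpoly_transpose] at h2
  exact h2.symm

/-- By the Cayley-Hamilton theorem and because the powers of a Hermitian matrix have the same kernel,
`charpolyInv` inverts the Gram matrix on its range. -/
theorem pinv_eq_charpolyInv {m : Type*} [Fintype m] {A : Matrix m n ℂ} {r : ℕ}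
    (hr : (Aᴴ * A).charpoly.coeff r ≠ 0) (hlt : ∀ k < r, (Aᴴ * A).charpoly.coeff k = 0) :
    pinv A = charpolyInv (Aᴴ * A) r * (Aᴴ * A) * charpolyInv (Aᴴ * A) r * Aᴴ := by
  refine (pinv_spec A).unique ?_
  set S := Aᴴ * A with hS
  have hSh : S.IsHermitian := Matrix.isHermitian_conjTranspose_mul_self A
  set X := charpolyInv S r with hX
  obtain ⟨g, hg⟩ := Polynomial.X_pow_dvd_iff.2 hlt
  have hgc : ∀ k, g.coeff k = S.charpoly.coeff (k + r) := fun k => by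
    rw [hg, Polynomial.coeff_X_pow_mul]
  have hdeg : g.divX.natDegree < Fintype.card n + 1 := by
    rw [Nat.lt_succ_iff, Polynomial.natDegree_le_iff_coeff_eq_zero]
    intro N hN
    rw [Polynomial.coeff_divX, hgc]
    refine Polynomial.coeff_eq_zero_of_natDegree_lt ?_
    rw [Matrix.charpoly_natDegree_eq_dim]
    omega
  have hXa : X = (-(S.charpoly.coeff r)⁻¹) • Polynomial.aeval S g.divX := by
    rw [hX, charpolyInv, Polynomial.aeval_eq_sum_range' hdeg]
    simp [Polynomial.coeff_divX, hgc]
  have hcomm : S * X = X * S := by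
    rw [hXa, Matrix.mul_smul, Matrix.smul_mul]
    congr 1
    exact ((Polynomial.aeval_eq_sum_range' hdeg S) ▸ Commute.sum_right _ _ _ fun k _ =>
      ((Commute.refl S).pow_right k).smul_right _ : Commute S (Polynomial.aeval S g.divX))
  have hXh : Xᴴ = X := by
    rw [hX, charpolyInv, Matrix.conjTranspose_smul, Matrix.conjTranspose_sum]
    simp only [Matrix.conjTranspose_smul, Matrix.conjTranspose_pow, hSh.eq,
      hSh.star_charpoly_coeff, star_neg, star_inv₀]
  have hSX : S * X * S = S := by
    have h0 : S ^ r * Polynomial.aeval S g = 0 := by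
      have := Matrix.aeval_self_charpoly S
      rwa [hg, map_mul, map_pow, Polynomial.aeval_X] at this
    have h1 := hSh.mul_eq_zero_of_pow_mul_eq_zero r h0
    rw [← Polynomial.X_mul_divX_add g, map_add, map_mul, Polynomial.aeval_X, Polynomial.aeval_C,
      hgc, zero_add, mul_add, Algebra.algebraMap_eq_smul_one, Matrix.mul_smul, Matrix.mul_one]
      at h1
    rw [Matrix.mul_assoc, ← hcomm, hXa, Matrix.mul_smul, Matrix.mul_smul,
      eq_neg_of_add_eq_zero_left h1, smul_neg, neg_smul, neg_neg, smul_smul, inv_mul_cancel₀ hr,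
      one_smul]
  refine isMoorePenrose_of_gram ?_ ?_ ?_ ?_
  · rw [Matrix.conjTranspose_mul, Matrix.conjTranspose_mul, hXh, hSh.eq,
      ← Matrix.mul_assoc]
  · calc X * S * X * S * (X * S * X) = X * (S * X * S) * (X * S * X) := by
          simp only [Matrix.mul_assoc]
      _ = X * S * (X * S * X) := by rw [hSX]
      _ = X * (S * X * S) * X := by simp only [Matrix.mul_assoc]
      _ = X * S * X := by rw [hSX]
  · calc S * (X * S * X) * S = (S * X * S) * X * S := by simp only [Matrix.mul_assoc]
      _ = S := by rw [hSX, hSX]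
  · calc S * (X * S * X) = (S * X) * (S * X) := by simp only [Matrix.mul_assoc]
      _ = X * S * (X * S) := by rw [hcomm]
      _ = X * S * X * S := by simp only [Matrix.mul_assoc]

end Pinv

namespace IsArithClosed

variable {X : Type*} {S : Subalgebra ℂ (X → ℂ)}

theorem const_mem (S : Subalgebra ℂ (X → ℂ)) (c : ℂ) : (fun _ => c) ∈ S :=
  S.algebraMap_mem c

theorem matrix_mul_mem {l m n : Type*} [Fintype m] {A : X → Matrix l m ℂ} {B : X → Matrix m n ℂ}
    (hA : ∀ i j, (fun x => A x i j) ∈ S) (hB : ∀ i j, (fun x => B x i j) ∈ S) (i : l) (j : n) :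
    (fun x => (A x * B x) i j) ∈ S := by
  have : (fun x => (A x * B x) i j) = ∑ k, (fun x => A x i k) * (fun x => B x k j) := by
    funext x; simp [Matrix.mul_apply]
  rw [this]
  exact sum_mem fun k _ => mul_mem (hA i k) (hB k j)

theorem matrix_pow_mem {n : Type*} [Fintype n] [DecidableEq n] {A : X → Matrix n n ℂ}
    (hA : ∀ i j, (fun x => A x i j) ∈ S) (k : ℕ) :
    ∀ i j, (fun x => (A x ^ k) i j) ∈ S := by
  induction k with
  | zero => intro i j; simpa [Matrix.one_apply] using const_mem S _
  | succ k ih =>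
    intro i j
    simp only [pow_succ]
    exact matrix_mul_mem ih hA i j

theorem charpoly_coeff_mem {n : Type*} [Fintype n] [DecidableEq n] {A : X → Matrix n n ℂ}
    (hA : ∀ i j, (fun x => A x i j) ∈ S) (k : ℕ) :
    (fun x => (A x).charpoly.coeff k) ∈ S := by
  let B : Matrix n n S := Matrix.of fun i j => ⟨fun x => A x i j, hA i j⟩
  have h : ∀ x, ((B.charpoly.coeff k : S) : X → ℂ) x = (A x).charpoly.coeff k := by
    intro x
    let φ : S →+* ℂ := (Pi.evalRingHom (fun _ : X => ℂ) x).comp S.val.toRingHom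
    have h1 : B.map φ = A x := by ext i j; rfl
    have := congrArg (fun p => Polynomial.coeff p k) (Matrix.charpoly_map B φ)
    simp only [Polynomial.coeff_map, h1] at this
    exact this.symm
  have : (fun x => (A x).charpoly.coeff k) = ((B.charpoly.coeff k : S) : X → ℂ) := by
    funext x; exact (h x).symm
  rw [this]
  exact (B.charpoly.coeff k).2

theorem conjTranspose_mem (hS : IsArithClosed S) {m n : Type*} {A : X → Matrix m n ℂ}
    (hA : ∀ i j, (fun x => A x i j) ∈ S) (i : n) (j : m) : (fun x => (A x)ᴴ i j) ∈ S :=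
  hS.star_mem (hA j i)

/-- The multiplicity of `0` as a root of the characteristic polynomial of the Gram matrix varies
with the argument; the case distinction is itself arithmetic, because `z * z⁻¹` is the indicator
of `z ≠ 0`. -/
theorem pinv_mem (hS : IsArithClosed S) {m n : Type*} [Fintype m] [Fintype n]
    {A : X → Matrix m n ℂ} (hA : ∀ i j, (fun x => A x i j) ∈ S) (i : n) (j : m) :
    (fun x => pinv (A x) i j) ∈ S := by
  classical
  set G : X → Matrix n n ℂ := fun x => (A x)ᴴ * A x with hG
  have hAh := hS.conjTranspose_mem hA
  have hGm : ∀ i j, (fun x => G x i j) ∈ S := matrix_mul_mem hAh hA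
  set c : ℕ → X → ℂ := fun k x => (G x).charpoly.coeff k with hc
  have hcm : ∀ k, c k ∈ S := charpoly_coeff_mem hGm
  have hCm : ∀ r i j, (fun x => charpolyInv (G x) r i j) ∈ S := by
    intro r i j
    have : (fun x => charpolyInv (G x) r i j) = (-(c r)⁻¹) *
        ∑ k ∈ Finset.range (Fintype.card n + 1), c (k + 1 + r) * fun x => (G x ^ k) i j := by
      funext x; simp [charpolyInv, hc, Matrix.sum_apply]
    rw [this]
    exact mul_mem (neg_mem (hS.inv_mem (hcm r)))
      (sum_mem fun k _ => mul_mem (hcm _) (matrix_pow_mem hGm k i j))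
  set B : ℕ → X → Matrix n m ℂ := fun r x =>
    charpolyInv (G x) r * G x * charpolyInv (G x) r * (A x)ᴴ with hB
  have hBm : ∀ r i j, (fun x => B r x i j) ∈ S := fun r =>
    matrix_mul_mem (matrix_mul_mem (matrix_mul_mem (hCm r) hGm) (hCm r)) hAh
  have key : (fun x => pinv (A x) i j) = ∑ r ∈ Finset.range (Fintype.card n + 1),
      (c r * (c r)⁻¹ * ∏ k ∈ Finset.range r, (1 - c k * (c k)⁻¹)) * fun x => B r x i j := by
    funext x
    have hex : ∃ r, c r x ≠ 0 := ⟨Fintype.card n, by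
      have h1 := (Matrix.charpoly_monic (G x)).coeff_natDegree
      rw [Matrix.charpoly_natDegree_eq_dim] at h1
      simp [hc, h1]⟩
    set r := Nat.find hex with hr
    have hr0 : c r x ≠ 0 := Nat.find_spec hex
    have hlt : ∀ k < r, c k x = 0 := fun k hk => not_not.1 (Nat.find_min hex hk)
    have hrn : r ≤ Fintype.card n := by
      refine Nat.find_le ?_
      have h1 := (Matrix.charpoly_monic (G x)).coeff_natDegree
      rw [Matrix.charpoly_natDegree_eq_dim] at h1
      simp [hc, h1]
    have hp : pinv (A x) = B r x := pinv_eq_charpolyInv hr0 hlt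
    simp only [Finset.sum_apply, Pi.mul_apply, Finset.prod_apply, Pi.inv_apply, Pi.sub_apply,
      Pi.one_apply]
    rw [Finset.sum_eq_single r, hp, mul_inv_cancel₀ hr0, Finset.prod_eq_one, one_mul, one_mul]
    · intro k hk
      simp [hlt k (Finset.mem_range.1 hk)]
    · intro s _ hs
      rcases lt_or_gt_of_ne hs with h | h
      · simp [hlt s h]
      · rw [Finset.prod_eq_zero (Finset.mem_range.2 h)]
        · simp
        · simp [mul_inv_cancel₀ hr0]
    · intro h
      exact absurd (Finset.mem_range.2 (Nat.lt_succ_of_le hrn)) h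
  rw [key]
  exact sum_mem fun r _ => mul_mem (mul_mem (mul_mem (hcm r) (hS.inv_mem (hcm r)))
    (prod_mem fun k _ => sub_mem (one_mem S) (mul_mem (hcm k) (hS.inv_mem (hcm k))))) (hBm r i j)

/-- Along a matrix-valued function with entries in an arithmetically closed class, every algebraic
map has entries in this class. -/
theorem algebraicMap_mem (hS : IsArithClosed S) {κ τ : Type} {ρ : X → Matrix κ τ ℂ}
    (hρ : ∀ i j, (fun x => ρ x i j) ∈ S) {m n : Type} {f : Matrix κ τ ℂ → Matrix m n ℂ}
    (hf : IsAlgebraicMap f) : ∀ i j, (fun x => f (ρ x) i j) ∈ S := by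
  induction hf with
  | channel => exact hρ
  | const C => exact fun i j => const_mem S _
  | add _ _ ih1 ih2 => exact fun i j => add_mem (ih1 i j) (ih2 i j)
  | mul _ _ ih1 ih2 => exact matrix_mul_mem ih1 ih2
  | conjTranspose _ ih => exact hS.conjTranspose_mem ih
  | @norm m n _ _ f _ ih =>
    intro _ _
    refine hS.sqrt_mem (f := fun x => ∑ i, ∑ j, ‖f (ρ x) i j‖ ^ 2) (fun x => by positivity) ?_
    have : (fun x => ((∑ i, ∑ j, ‖f (ρ x) i j‖ ^ 2 : ℝ) : ℂ))
        = ∑ i, ∑ j, star (fun x => f (ρ x) i j) * fun x => f (ρ x) i j := by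
      funext x
      simp [Complex.conj_mul']
    rw [this]
    exact sum_mem fun i _ => sum_mem fun j _ => mul_mem (hS.star_mem (ih i j)) (ih i j)
  | ginv _ ih => exact hS.pinv_mem ih

end IsArithClosed

/-! ### Events whose probability tends to one at a polynomial rate -/

theorem eventually_const_mul_rpow_le (k : ℝ) {a b : ℝ} (hab : a < b) :
    ∀ᶠ P : ℝ in atTop, k * P ^ a ≤ P ^ b := by
  filter_upwards [(tendsto_rpow_atTop (sub_pos.2 hab)).eventually_ge_atTop k,
    eventually_gt_atTop 0] with P h hP
  calc k * P ^ a ≤ P ^ (b - a) * P ^ a := by gcongr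
    _ = P ^ b := by rw [← Real.rpow_add hP]; congr 1; ring

section Whp

variable {Ω : Type*} [MeasurableSpace Ω] (Pr : Measure Ω) [IsFiniteMeasure Pr]

/-- The filter of the sets of pairs `(P, ω)` whose complement has, at SNR `P`, probability
`O(P ^ (-ε))` for some `ε > 0`: `∀ᶠ p in whp Pr, q p` means that `q` holds with probability
`1 - O(P ^ (-ε))`. -/
def whp : Filter (ℝ × Ω) where
  sets := {S | ∃ ε : ℝ, 0 < ε ∧
    (fun P => Pr.real {ω | (P, ω) ∉ S}) =O[atTop] fun P : ℝ => P ^ (-ε)}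
  univ_sets := ⟨1, one_pos, by simpa using isBigO_zero _ _⟩
  sets_of_superset := by
    rintro S T ⟨ε, hε, h⟩ hST
    refine ⟨ε, hε, IsBigO.trans (IsBigO.of_bound 1 (Eventually.of_forall fun P => ?_)) h⟩
    rw [one_mul, Real.norm_of_nonneg measureReal_nonneg, Real.norm_of_nonneg measureReal_nonneg]
    exact measureReal_mono fun ω hω h' => hω (hST h')
  inter_sets := by
    rintro S T ⟨ε, hε, h⟩ ⟨δ, hδ, h'⟩
    have hpow : ∀ {a b : ℝ}, a ≤ b →
        (fun P : ℝ => P ^ (-b)) =O[atTop] fun P : ℝ => P ^ (-a) := by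
      intro a b hab
      refine IsBigO.of_bound 1 ?_
      filter_upwards [eventually_ge_atTop 1] with P hP
      rw [one_mul, Real.norm_of_nonneg (by positivity), Real.norm_of_nonneg (by positivity)]
      exact Real.rpow_le_rpow_of_exponent_le hP (neg_le_neg hab)
    refine ⟨min ε δ, lt_min hε hδ, IsBigO.trans (IsBigO.of_bound 1 (Eventually.of_forall
      fun P => ?_)) ((h.trans (hpow (min_le_left _ _))).add (h'.trans (hpow (min_le_right _ _))))⟩
    rw [one_mul, Real.norm_of_nonneg measureReal_nonneg, Real.norm_of_nonneg (by positivity)]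
    refine (measureReal_mono fun ω hω => ?_).trans (measureReal_union_le _ _)
    by_contra hcon
    simp only [Set.mem_union, Set.mem_ofPred_eq, not_or, not_not] at hcon
    exact hω ⟨hcon.1, hcon.2⟩

variable {Pr}

theorem eventually_whp {q : ℝ × Ω → Prop} :
    (∀ᶠ p in whp Pr, q p) ↔ ∃ ε : ℝ, 0 < ε ∧
      (fun P => Pr.real {ω | ¬ q (P, ω)}) =O[atTop] fun P : ℝ => P ^ (-ε) :=
  Iff.rfl

theorem eventually_whp_of_measure_le {q : ℝ × Ω → Prop} {ε : ℝ} (hε : 0 < ε) {D : ℝ}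
    (h : ∀ᶠ P : ℝ in atTop, Pr {ω | ¬ q (P, ω)} ≤ ENNReal.ofReal (D * P ^ (-ε))) :
    ∀ᶠ p in whp Pr, q p := by
  refine eventually_whp.2 ⟨ε, hε, IsBigO.of_bound |D| ?_⟩
  filter_upwards [h, eventually_ge_atTop 0] with P hP hP0
  rw [Real.norm_of_nonneg measureReal_nonneg, Real.norm_of_nonneg (by positivity)]
  refine (ENNReal.toReal_mono ENNReal.ofReal_ne_top hP).trans ?_
  rw [ENNReal.toReal_ofReal']
  refine max_le ?_ (by positivity)
  gcongr
  exact le_abs_self D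

theorem eventually_whp_of_ae {q : ℝ × Ω → Prop}
    (h : ∀ᶠ P : ℝ in atTop, ∀ᵐ ω ∂Pr, q (P, ω)) : ∀ᶠ p in whp Pr, q p := by
  refine eventually_whp_of_measure_le one_pos (D := 0) ?_
  filter_upwards [h] with P hP
  rw [ae_iff.1 hP]
  exact zero_le

theorem tendsto_fst_whp : Tendsto Prod.fst (whp Pr) atTop := by
  intro s hs
  exact eventually_whp_of_ae (q := fun p => p.1 ∈ s) (by
    filter_upwards [hs] with P hP
    exact ae_of_all _ fun _ => hP)

variable (Pr) in
/-- `‖x‖` grows more slowly than every positive power of the SNR, with high probability. -/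
def IsSubpoly (x : ℝ × Ω → ℂ) : Prop :=
  ∀ ε : ℝ, 0 < ε → ∀ᶠ p in whp Pr, ‖x p‖ ≤ p.1 ^ ε

variable (Pr) in
/-- Where `x` does not vanish, `‖x‖` decays more slowly than every negative power of the SNR,
with high probability. -/
def IsAwayFromZero (x : ℝ × Ω → ℂ) : Prop :=
  ∀ ε : ℝ, 0 < ε → ∀ᶠ p in whp Pr, x p = 0 ∨ p.1 ^ (-ε) ≤ ‖x p‖

variable (Pr) in
/-- The distance of `x` and `y` is essentially of order `P ^ (-b)`, with high probability. -/
def IsClose (b : ℝ) (x y : ℝ × Ω → ℂ) : Prop :=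
  ∀ β : ℝ, β < b → ∀ᶠ p in whp Pr, ‖x p - y p‖ ≤ p.1 ^ (-β)

variable {x y x' y' : ℝ × Ω → ℂ} {b : ℝ}

theorem IsSubpoly.mono (hx : IsSubpoly Pr x) (h : ∀ᶠ p in whp Pr, ‖y p‖ ≤ ‖x p‖) :
    IsSubpoly Pr y := fun ε hε => by
  filter_upwards [hx ε hε, h] with p h1 h2 using h2.trans h1

theorem IsSubpoly.add (hx : IsSubpoly Pr x) (hy : IsSubpoly Pr y) :
    IsSubpoly Pr fun p => x p + y p := fun ε hε => by
  filter_upwards [hx (ε / 2) (by positivity), hy (ε / 2) (by positivity),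
    tendsto_fst_whp.eventually (eventually_const_mul_rpow_le 2 (half_lt_self hε))] with p h1 h2 h3
  linarith [norm_add_le (x p) (y p)]

theorem IsSubpoly.mul (hx : IsSubpoly Pr x) (hy : IsSubpoly Pr y) :
    IsSubpoly Pr fun p => x p * y p := fun ε hε => by
  filter_upwards [hx (ε / 2) (by positivity), hy (ε / 2) (by positivity),
    tendsto_fst_whp.eventually (eventually_gt_atTop 0)] with p h1 h2 h3
  rw [norm_mul, ← add_halves ε, Real.rpow_add h3]
  gcongr

theorem IsSubpoly.const (c : ℂ) : IsSubpoly Pr (fun _ : ℝ × Ω => c) := fun ε hε => by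
  filter_upwards [tendsto_fst_whp.eventually ((tendsto_rpow_atTop hε).eventually_ge_atTop ‖c‖)]
    with p h using h

theorem IsSubpoly.sum {ι : Type*} (s : Finset ι) {z : ι → ℝ × Ω → ℂ}
    (h : ∀ i ∈ s, IsSubpoly Pr (z i)) : IsSubpoly Pr fun p => ∑ i ∈ s, z i p := by
  classical
  induction s using Finset.induction_on with
  | empty => simpa using IsSubpoly.const 0
  | insert a s ha ih =>
    simp only [Finset.sum_insert ha]
    exact (h a (Finset.mem_insert_self _ _)).add
      (ih fun i hi => h i (Finset.mem_insert_of_mem hi))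

theorem IsAwayFromZero.subpoly_inv (hx : IsAwayFromZero Pr x) :
    IsSubpoly Pr fun p => (x p)⁻¹ := fun ε hε => by
  filter_upwards [hx ε hε, tendsto_fst_whp.eventually (eventually_gt_atTop 0)] with p h hp
  rcases h with h | h
  · rw [h, inv_zero, norm_zero]; positivity
  · rw [norm_inv]
    calc ‖x p‖⁻¹ ≤ (p.1 ^ (-ε))⁻¹ := by gcongr
      _ = p.1 ^ ε := by rw [Real.rpow_neg hp.le, inv_inv]

theorem IsClose.of_le {b' : ℝ} (h : IsClose Pr b x y) (hb : b' ≤ b) : IsClose Pr b' x y :=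
  fun β hβ => h β (hβ.trans_le hb)

theorem IsClose.refl : IsClose Pr b x x := fun β _ => by
  filter_upwards [tendsto_fst_whp.eventually (eventually_gt_atTop 0)] with p hp
  simp only [sub_self, norm_zero]
  positivity

theorem IsClose.add (hx : IsClose Pr b x x') (hy : IsClose Pr b y y') :
    IsClose Pr b (fun p => x p + y p) (fun p => x' p + y' p) := fun β hβ => by
  obtain ⟨γ, h1, h2⟩ := exists_between hβ
  filter_upwards [hx γ h2, hy γ h2, tendsto_fst_whp.eventually
    (eventually_const_mul_rpow_le 2 (neg_lt_neg h1))] with p h3 h4 h5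
  calc ‖x p + y p - (x' p + y' p)‖ = ‖(x p - x' p) + (y p - y' p)‖ := by ring_nf
    _ ≤ p.1 ^ (-β) := by linarith [norm_add_le (x p - x' p) (y p - y' p)]

theorem IsClose.mul_zero_of_subpoly (hx : IsSubpoly Pr x) (hy : IsClose Pr b y 0) :
    IsClose Pr b (fun p => x p * y p) 0 := fun β hβ => by
  obtain ⟨γ, h1, h2⟩ := exists_between hβ
  filter_upwards [hx (γ - β) (sub_pos.2 h1), hy γ h2,
    tendsto_fst_whp.eventually (eventually_gt_atTop 0)] with p h3 h4 h5
  simp only [Pi.zero_apply, sub_zero] at h4 ⊢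
  calc ‖x p * y p‖ ≤ p.1 ^ (γ - β) * p.1 ^ (-γ) := by rw [norm_mul]; gcongr
    _ = p.1 ^ (-β) := by rw [← Real.rpow_add h5]; congr 1; ring

theorem IsClose.sub_zero_iff : IsClose Pr b (fun p => x p - y p) 0 ↔ IsClose Pr b x y := by
  simp [IsClose]

theorem IsClose.mul (hx : IsClose Pr b x x') (hy : IsClose Pr b y y')
    (hsx : IsSubpoly Pr x) (hsy : IsSubpoly Pr y') :
    IsClose Pr b (fun p => x p * y p) (fun p => x' p * y' p) := by
  have h1 := IsClose.mul_zero_of_subpoly hsx (IsClose.sub_zero_iff.2 hy)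
  have h2 := IsClose.mul_zero_of_subpoly hsy (IsClose.sub_zero_iff.2 hx)
  refine IsClose.sub_zero_iff.1 ?_
  have := h1.add h2
  convert this using 2
  · ring
  · simp

theorem IsClose.symm {b : ℝ} {x y : ℝ × Ω → ℂ} (h : IsClose Pr b x y) : IsClose Pr b y x :=
  fun β hβ => by simpa only [norm_sub_rev] using h β hβ

theorem IsClose.trans {b : ℝ} {x y z : ℝ × Ω → ℂ} (h : IsClose Pr b x y)
    (h' : IsClose Pr b y z) : IsClose Pr b x z := by
  refine IsClose.sub_zero_iff.1 ?_
  have := (IsClose.sub_zero_iff.2 h).add (IsClose.sub_zero_iff.2 h')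
  convert this using 1
  · funext p; ring
  · funext p; simp

theorem IsClose.sum_zero {ι : Type*} (s : Finset ι) {z : ι → ℝ × Ω → ℂ}
    (h : ∀ i ∈ s, IsClose Pr b (z i) 0) : IsClose Pr b (fun p => ∑ i ∈ s, z i p) 0 := by
  classical
  induction s using Finset.induction_on with
  | empty => simpa using! IsClose.refl (x := (0 : ℝ × Ω → ℂ))
  | insert a s ha ih =>
    simp only [Finset.sum_insert ha]
    have := (h a (Finset.mem_insert_self _ _)).add
      (ih fun i hi => h i (Finset.mem_insert_of_mem hi))
    convert this using 1
    funext p; simp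

theorem IsClose.conj (hx : IsClose Pr b x x') :
    IsClose Pr b (fun p => star (x p)) (fun p => star (x' p)) := fun β hβ => by
  filter_upwards [hx β hβ] with p h
  rwa [← star_sub, norm_star]

/-- Quantities at a positive distance exponent vanish simultaneously, with high probability, so
that pointwise inversion is as harmless as for nonvanishing quantities. -/
theorem IsClose.inv (hb : 0 < b) (hx : IsClose Pr b x x') (h : IsAwayFromZero Pr x)
    (h' : IsAwayFromZero Pr x') :
    IsClose Pr b (fun p => (x p)⁻¹) (fun p => (x' p)⁻¹) := fun β hβ => by
  have key := IsClose.mul_zero_of_subpoly (h.subpoly_inv.mul h'.subpoly_inv)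
    (IsClose.sub_zero_iff.2 hx)
  filter_upwards [key β hβ, hx (b / 2) (half_lt_self hb), h (b / 4) (by positivity),
    h' (b / 4) (by positivity), tendsto_fst_whp.eventually (eventually_gt_atTop 0),
    tendsto_fst_whp.eventually
      (eventually_const_mul_rpow_le 2 (show -(b / 2) < -(b / 4) by linarith))]
    with p h1 h2 h3 h4 h5 h6
  have hpos : 0 < p.1 ^ (-(b / 2)) := by positivity
  by_cases hx0 : x p = 0
  · have : x' p = 0 := by
      refine h4.resolve_right fun h4 => ?_
      rw [hx0, zero_sub, norm_neg] at h2
      linarith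
    simp only [hx0, this, sub_self, norm_zero]
    positivity
  · have hx'0 : x' p ≠ 0 := by
      intro h0
      rw [h0, sub_zero] at h2
      linarith [h3.resolve_left hx0]
    simp only [Pi.zero_apply, sub_zero] at h1
    refine le_of_eq_of_le ?_ h1
    rw [inv_sub_inv hx0 hx'0, ← norm_neg]
    congr 1
    field_simp
    ring

/-- The square roots vanish simultaneously or have a sum that is not tiny, by which their distance
is `|u - v|` divided. -/
theorem IsClose.sqrt {u v : ℝ × Ω → ℝ} (hu : ∀ p, 0 ≤ u p) (hv : ∀ p, 0 ≤ v p)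
    (huv : IsClose Pr b (fun p => (u p : ℂ)) (fun p => (v p : ℂ)))
    (h : IsAwayFromZero Pr fun p => ((√(u p) : ℝ) : ℂ))
    (h' : IsAwayFromZero Pr fun p => ((√(v p) : ℝ) : ℂ)) :
    IsClose Pr b (fun p => ((√(u p) : ℝ) : ℂ)) (fun p => ((√(v p) : ℝ) : ℂ)) := fun β hβ => by
  obtain ⟨γ, h1, h2⟩ := exists_between hβ
  filter_upwards [huv γ h2, h (γ - β) (sub_pos.2 h1),
    h' (γ - β) (sub_pos.2 h1), tendsto_fst_whp.eventually (eventually_gt_atTop 0)]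
    with p h3 h4 h5 h6
  have e1 : ((√(u p) : ℝ) : ℂ) - ((√(v p) : ℝ) : ℂ) = ((√(u p) - √(v p) : ℝ) : ℂ) := by
    push_cast; rfl
  have e2 : (u p : ℂ) - (v p : ℂ) = ((u p - v p : ℝ) : ℂ) := by push_cast; rfl
  simp only [e2, Complex.norm_real, Complex.ofReal_eq_zero, Real.norm_eq_abs,
    abs_of_nonneg (Real.sqrt_nonneg _)] at h3 h4 h5
  rw [e1, Complex.norm_real, Real.norm_eq_abs]
  have hmul : |√(u p) - √(v p)| * (√(u p) + √(v p)) = |u p - v p| := by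
    rw [← abs_of_nonneg (add_nonneg (Real.sqrt_nonneg (u p)) (Real.sqrt_nonneg (v p))), ← abs_mul]
    congr 1
    nlinarith [Real.sq_sqrt (hu p), Real.sq_sqrt (hv p)]
  by_cases hz : √(u p) = 0 ∧ √(v p) = 0
  · rw [hz.1, hz.2, sub_self, abs_zero]; positivity
  · have hs : p.1 ^ (-(γ - β)) ≤ √(u p) + √(v p) := by
      rcases not_and_or.1 hz with hz | hz
      · exact (h4.resolve_left hz).trans (le_add_of_nonneg_right (Real.sqrt_nonneg _))
      · exact (h5.resolve_left hz).trans (le_add_of_nonneg_left (Real.sqrt_nonneg _))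
    have hpos : 0 < p.1 ^ (-(γ - β)) := by positivity
    have : |√(u p) - √(v p)| * p.1 ^ (-(γ - β)) ≤ p.1 ^ (-γ) :=
      (mul_le_mul_of_nonneg_left hs (abs_nonneg _)).trans (hmul.le.trans h3)
    refine le_of_mul_le_mul_right (this.trans (le_of_eq ?_)) hpos
    rw [← Real.rpow_add h6]; congr 1; ring

end Whp

/-! ### Algebraic functions of real coordinates -/

section Algebraic

variable {E σ : Type*} (c : E → σ → ℝ)

/-- Complex polynomials, evaluated at the real coordinates `c`. -/
noncomputable def polyEval : MvPolynomial σ ℂ →+* (E → ℂ) :=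
  RingHom.pi fun x => MvPolynomial.eval fun s => (c x s : ℂ)

@[simp]
theorem polyEval_apply (Q : MvPolynomial σ ℂ) (x : E) :
    polyEval c Q x = MvPolynomial.eval (fun s => (c x s : ℂ)) Q := rfl

/-- The specialization, at a point, of a polynomial whose coefficients are polynomials in the
coordinates `c`. -/
noncomputable def specialize (x : E) : Polynomial (MvPolynomial σ ℂ) →+* Polynomial ℂ :=
  Polynomial.mapRingHom (MvPolynomial.eval fun s => (c x s : ℂ))

theorem specialize_coeff (x : E) (q : Polynomial (MvPolynomial σ ℂ)) (k : ℕ) :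
    (specialize c x q).coeff k = polyEval c (q.coeff k) x := by
  simp [specialize]

theorem isAlgebraic_polyEval_iff (f : E → ℂ) :
    (letI := (polyEval c).toAlgebra; IsAlgebraic (MvPolynomial σ ℂ) f) ↔
      ∃ q : Polynomial (MvPolynomial σ ℂ), q ≠ 0 ∧ ∀ x, (specialize c x q).eval (f x) = 0 := by
  let := (polyEval c).toAlgebra
  refine exists_congr fun q => and_congr_right fun _ => ?_
  rw [funext_iff]
  refine forall_congr' fun x => ?_
  have : (Polynomial.aeval f q) x = (specialize c x q).eval (f x) := by
    rw [Polynomial.aeval_def, specialize, Polynomial.coe_mapRingHom, Polynomial.eval_map]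
    exact Polynomial.hom_eval₂ q (polyEval c) (Pi.evalRingHom (fun _ : E => ℂ) x) f
  rw [this]
  rfl

/-- The functions that are algebraic over the polynomials in the real coordinates `c`. No
continuity or measurability is implied. -/
noncomputable def algebraicFun : Subalgebra ℂ (E → ℂ) where
  carrier := {f | letI := (polyEval c).toAlgebra; IsAlgebraic (MvPolynomial σ ℂ) f}
  mul_mem' ha hb := by
    let := (polyEval c).toAlgebra
    exact IsAlgebraic.mul ha hb
  add_mem' ha hb := by
    let := (polyEval c).toAlgebra
    exact IsAlgebraic.add ha hb
  algebraMap_mem' a := by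
    refine (isAlgebraic_polyEval_iff c _).2 ⟨Polynomial.X - Polynomial.C (MvPolynomial.C a),
      Polynomial.X_sub_C_ne_zero _, fun x => ?_⟩
    simp [specialize]

variable {c}

theorem mem_algebraicFun {f : E → ℂ} : f ∈ algebraicFun c ↔
    ∃ q : Polynomial (MvPolynomial σ ℂ), q ≠ 0 ∧ ∀ x, (specialize c x q).eval (f x) = 0 :=
  isAlgebraic_polyEval_iff c f

theorem coord_mem_algebraicFun (s : σ) : (fun x => (c x s : ℂ)) ∈ algebraicFun c :=
  mem_algebraicFun.2 ⟨Polynomial.X - Polynomial.C (MvPolynomial.X s),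
    Polynomial.X_sub_C_ne_zero _, fun x => by simp [specialize]⟩

variable (c) in
theorem isArithClosed_algebraicFun : IsArithClosed (algebraicFun c) where
  star_mem := by
    intro f hf
    obtain ⟨q, hq, h⟩ := mem_algebraicFun.1 hf
    refine mem_algebraicFun.2 ⟨q.map (MvPolynomial.map (starRingEnd ℂ)), ?_, fun x => ?_⟩
    · rwa [Ne, Polynomial.map_eq_zero_iff
        (MvPolynomial.map_injective _ (starRingEnd ℂ).injective)]
    · have e : (MvPolynomial.eval fun s => (c x s : ℂ)).comp (MvPolynomial.map (starRingEnd ℂ))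
          = (starRingEnd ℂ).comp (MvPolynomial.eval fun s => (c x s : ℂ)) := by
        refine MvPolynomial.ringHom_ext (fun a => by simp) fun s => by simp
      have h1 := congrArg (starRingEnd ℂ) (h x)
      rw [map_zero, specialize, Polynomial.coe_mapRingHom, Polynomial.eval_map,
        Polynomial.hom_eval₂, ← e, ← Polynomial.eval_map, ← Polynomial.map_map] at h1
      exact h1
  inv_mem := by
    intro f hf
    obtain ⟨q, hq, h⟩ := mem_algebraicFun.1 hf
    -- the factor `X` accounts for the points at which `f` vanishes
    refine mem_algebraicFun.2 ⟨Polynomial.X * q.reverse,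
      mul_ne_zero Polynomial.X_ne_zero (by simpa using hq), fun x => ?_⟩
    rw [map_mul, Polynomial.eval_mul, specialize, Polynomial.coe_mapRingHom, Polynomial.map_X,
      Polynomial.eval_X, Pi.inv_apply]
    by_cases hx : f x = 0
    · simp [hx]
    · rw [Polynomial.eval_map]
      have h1 := h x
      rw [specialize, Polynomial.coe_mapRingHom, Polynomial.eval_map] at h1
      have hu : Invertible (f x) := invertibleOfNonzero hx
      have := (Polynomial.eval₂_reverse_eq_zero_iff
        (MvPolynomial.eval fun s => (c x s : ℂ)) (f x) q).2 h1
      rw [invOf_eq_inv] at this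
      rw [this, mul_zero]
  sqrt_mem := by
    intro f h0 hf
    obtain ⟨q, hq, h⟩ := mem_algebraicFun.1 hf
    refine mem_algebraicFun.2 ⟨Polynomial.expand _ 2 q,
      (Polynomial.expand_ne_zero two_pos).2 hq, fun x => ?_⟩
    have h1 := h x
    rw [specialize, Polynomial.coe_mapRingHom] at h1 ⊢
    rw [Polynomial.map_expand, Polynomial.expand_eval, ← Complex.ofReal_pow, Real.sq_sqrt (h0 x)]
    exact h1

theorem re_im_mem {S : Subalgebra ℂ (E → ℂ)} {f : E → ℂ}
    (hr : (fun x => ((f x).re : ℂ)) ∈ S) (hi : (fun x => ((f x).im : ℂ)) ∈ S) : f ∈ S := by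
  have : f = (fun x => ((f x).re : ℂ)) + (fun x => ((f x).im : ℂ)) * fun _ => Complex.I := by
    funext x
    exact (Complex.re_add_im (f x)).symm
  rw [this]
  exact add_mem hr (mul_mem hi (IsArithClosed.const_mem S _))

/-! ### Algebraic functions of Gaussian coordinates -/

variable [Fintype σ]

/-- The law of a vector of independent real Gaussian variables of variance `1 / 2`. -/
noncomputable abbrev realGaussian (σ : Type*) [Fintype σ] : Measure (σ → ℝ) :=
  Measure.pi fun _ : σ => gaussianReal 0 (1 / 2)

/-- The zero set of a nonzero polynomial is a null set for a Gaussian vector. -/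
theorem ae_eval_ne_zero {Q : MvPolynomial σ ℂ} (hQ : Q ≠ 0) :
    ∀ᵐ x ∂(realGaussian σ), MvPolynomial.eval (fun s => (x s : ℂ)) Q ≠ 0 := by
  obtain ⟨C, hC⟩ := gaussianReal_half_le_volume
  obtain ⟨ε, hε, D, hD, h⟩ := MvPolynomial.exists_measure_norm_eval_lt_le hC hQ
  rw [ae_iff]
  have hlim : Tendsto (fun t : ℝ => ENNReal.ofReal (D * t ^ ε)) (nhdsWithin 0 (Set.Ioi 0))
      (nhds 0) := by
    have h1 : Tendsto (fun t : ℝ => D * t ^ ε) (nhds 0) (nhds 0) := by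
      have := ((Real.continuousAt_rpow_const 0 ε (Or.inr hε.le)).tendsto).const_mul D
      rwa [Real.zero_rpow hε.ne', mul_zero] at this
    have h2 := ENNReal.tendsto_ofReal h1
    rw [ENNReal.ofReal_zero] at h2
    exact h2.mono_left nhdsWithin_le_nhds
  refine le_antisymm (ge_of_tendsto hlim ?_) zero_le
  filter_upwards [Ioc_mem_nhdsGT one_pos] with t ht
  refine (measure_mono fun x hx => ?_).trans (h t ht.1 ht.2)
  simp only [Set.mem_ofPred_eq, not_not] at hx ⊢
  rw [hx, norm_zero]
  exact ht.1

variable {Ω : Type*} [MeasurableSpace Ω] {Pr : Measure Ω} [IsProbabilityMeasure Pr]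
  {Z : ℝ → Ω → E}

theorem isSubpoly_coord (hZ : ∀ P, 1 ≤ P → HasLaw (fun ω => c (Z P ω)) (realGaussian σ) Pr)
    (s : σ) : IsSubpoly Pr fun p => ((c (Z p.1 p.2) s : ℝ) : ℂ) := fun ε hε => by
  set D : ℝ := ∫ y, ‖y‖ ∂(gaussianReal 0 (1 / 2)) with hD
  have hint : Integrable (fun y : ℝ => y) (gaussianReal 0 (1 / 2)) := IsGaussian.integrable_id
  refine eventually_whp_of_measure_le hε (D := D) ?_
  filter_upwards [eventually_ge_atTop 1] with P hP
  have hP0 : 0 < P := by linarith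
  have hlaw : HasLaw (fun ω => c (Z P ω) s) (gaussianReal 0 (1 / 2)) Pr :=
    (HasLaw.mk (measurable_pi_apply s).aemeasurable
      (measurePreserving_eval (fun _ : σ => gaussianReal 0 (1 / 2)) s).map_eq).comp (hZ P hP)
  have hset : {ω | ¬ ‖((c (Z P ω) s : ℝ) : ℂ)‖ ≤ P ^ ε}
      ⊆ (fun ω => c (Z P ω) s) ⁻¹' {y | P ^ ε ≤ ‖y‖} := by
    intro ω hω
    simp only [Set.mem_ofPred_eq, not_le, Complex.norm_real] at hω
    exact hω.le
  refine (measure_mono hset).trans ((Measure.le_map_apply hlaw.aemeasurable _).trans ?_)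
  rw [hlaw.map_eq]
  have hm := mul_meas_ge_le_integral_of_nonneg (μ := gaussianReal 0 (1 / 2))
    (f := fun y : ℝ => ‖y‖) (ae_of_all _ fun y => norm_nonneg y) hint.norm (P ^ ε)
  rw [← ENNReal.ofReal_toReal (measure_ne_top (gaussianReal 0 (1 / 2)) {y : ℝ | P ^ ε ≤ ‖y‖})]
  refine ENNReal.ofReal_le_ofReal ?_
  rw [Real.rpow_neg hP0.le, ← div_eq_mul_inv, le_div_iff₀ (by positivity), mul_comm]
  exact hm

theorem isSubpoly_polyEval
    (hZ : ∀ P, 1 ≤ P → HasLaw (fun ω => c (Z P ω)) (realGaussian σ) Pr)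
    (Q : MvPolynomial σ ℂ) : IsSubpoly Pr fun p => polyEval c Q (Z p.1 p.2) := by
  induction Q using MvPolynomial.induction_on with
  | C a => simpa using IsSubpoly.const a
  | add p q hp hq => simpa using hp.add hq
  | mul_X p s hp => simpa using hp.mul (isSubpoly_coord hZ s)

theorem eventually_le_norm_polyEval
    (hZ : ∀ P, 1 ≤ P → HasLaw (fun ω => c (Z P ω)) (realGaussian σ) Pr)
    {Q : MvPolynomial σ ℂ} (hQ : Q ≠ 0) {ε : ℝ} (hε : 0 < ε) :
    ∀ᶠ p in whp Pr, p.1 ^ (-ε) ≤ ‖polyEval c Q (Z p.1 p.2)‖ := by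
  obtain ⟨C, hC⟩ := gaussianReal_half_le_volume
  obtain ⟨δ, hδ, D, hD, h⟩ := MvPolynomial.exists_measure_norm_eval_lt_le hC hQ
  refine eventually_whp_of_measure_le (mul_pos hε hδ) (D := D) ?_
  filter_upwards [eventually_ge_atTop 1] with P hP
  have hP0 : 0 < P := by linarith
  have h1 := h (P ^ (-ε)) (by positivity) (Real.rpow_le_one_of_one_le_of_nonpos hP (by linarith))
  rw [← Real.rpow_mul hP0.le, neg_mul] at h1
  refine le_trans ?_ h1
  have hmap : Measure.pi (fun _ : σ => gaussianReal 0 (1 / 2)) = Pr.map fun ω => c (Z P ω) :=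
    (hZ P hP).map_eq.symm
  rw [hmap]
  refine le_trans (measure_mono fun ω hω => ?_) (Measure.le_map_apply (hZ P hP).aemeasurable _)
  simpa using hω

/-- Divided by a power of the unknown, an algebraic equation of `f` has a nonzero constant term,
which is not tiny. Hence neither is `f`, where it does not vanish. -/
theorem isAwayFromZero_of_mem_algebraicFun
    (hZ : ∀ P, 1 ≤ P → HasLaw (fun ω => c (Z P ω)) (realGaussian σ) Pr)
    {f : E → ℂ} (hf : f ∈ algebraicFun c) :
    IsAwayFromZero Pr fun p => f (Z p.1 p.2) := fun ε hε => by
  obtain ⟨q₀, hq₀, hroot₀⟩ := mem_algebraicFun.1 hf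
  obtain ⟨q, hq, hndvd⟩ := Polynomial.exists_eq_pow_rootMultiplicity_mul_and_not_dvd q₀ hq₀ 0
  rw [Polynomial.C_0, sub_zero] at hq hndvd
  have h0 : q.coeff 0 ≠ 0 := fun h => hndvd (Polynomial.X_dvd_iff.2 h)
  have hroot : ∀ x, f x ≠ 0 → (specialize c x q).eval (f x) = 0 := by
    intro x hx
    have := hroot₀ x
    rw [hq, map_mul, map_pow, Polynomial.eval_mul, Polynomial.eval_pow] at this
    refine (mul_eq_zero.1 this).resolve_left (pow_ne_zero _ ?_)
    simpa [specialize] using hx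
  -- `r * f` is the nonconstant part of the equation; only the points with `‖f x‖ ≤ 1` matter, and
  -- the truncation makes the bound of `r` hold everywhere
  set r : E → ℂ := fun x => ∑ k ∈ Finset.range q.natDegree, polyEval c (q.coeff (k + 1)) x *
    (if ‖f x‖ ≤ 1 then f x else 0) ^ k with hr
  have hrs : IsSubpoly Pr fun p => r (Z p.1 p.2) := by
    refine IsSubpoly.sum _ fun k _ => (isSubpoly_polyEval hZ _).mul ?_
    refine (IsSubpoly.const 1).mono (Eventually.of_forall fun p => ?_)
    rw [norm_pow, norm_one]
    refine pow_le_one₀ (norm_nonneg _) ?_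
    split_ifs with h
    · exact h
    · simp
  filter_upwards [hrs (ε / 4) (by positivity),
    eventually_le_norm_polyEval hZ h0 (ε := ε / 4) (by positivity),
    tendsto_fst_whp.eventually (eventually_ge_atTop 1),
    tendsto_fst_whp.eventually
      (eventually_const_mul_rpow_le 2 (show -(3 * ε / 4) < -(ε / 4) by linarith))]
    with p h1 h2 h3 h4
  by_contra hcon
  rw [not_or, not_le] at hcon
  obtain ⟨hx, hlt⟩ := hcon
  set x := Z p.1 p.2
  have hp0 : 0 < p.1 := by linarith
  have hle1 : ‖f x‖ ≤ 1 := hlt.le.trans (Real.rpow_le_one_of_one_le_of_nonpos h3 (by linarith))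
  have heq : polyEval c (q.coeff 0) x = -(r x * f x) := by
    have h5 := hroot x hx
    have hdeg : (specialize c x q).natDegree < q.natDegree + 1 :=
      Nat.lt_succ_of_le Polynomial.natDegree_map_le
    rw [Polynomial.eval_eq_sum_range' hdeg, Finset.sum_range_succ'] at h5
    simp only [specialize_coeff, pow_zero, mul_one] at h5
    rw [eq_neg_iff_add_eq_zero, add_comm, ← h5]
    congr 1
    simp only [hr, if_pos hle1, Finset.sum_mul]
    refine Finset.sum_congr rfl fun k _ => ?_
    rw [pow_succ, mul_assoc]
  rw [heq, norm_neg, norm_mul] at h2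
  have h6 : ‖r x‖ * ‖f x‖ ≤ p.1 ^ (ε / 4) * p.1 ^ (-ε) := by gcongr
  rw [← Real.rpow_add hp0, show ε / 4 + -ε = -(3 * ε / 4) by ring] at h6
  have h7 : 0 < p.1 ^ (-(3 * ε / 4)) := by positivity
  linarith

/-- An upper bound for an algebraic function is a lower bound for its inverse. -/
theorem isSubpoly_of_mem_algebraicFun
    (hZ : ∀ P, 1 ≤ P → HasLaw (fun ω => c (Z P ω)) (realGaussian σ) Pr)
    {f : E → ℂ} (hf : f ∈ algebraicFun c) : IsSubpoly Pr fun p => f (Z p.1 p.2) := by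
  have := (isAwayFromZero_of_mem_algebraicFun hZ
    ((isArithClosed_algebraicFun c).inv_mem hf)).subpoly_inv
  simpa using this

variable {Z' : ℝ → Ω → E}

/-- The algebraic functions that keep the closeness of two processes. -/
noncomputable def closeFun (hZ : ∀ P, 1 ≤ P → HasLaw (fun ω => c (Z P ω)) (realGaussian σ) Pr)
    (hZ' : ∀ P, 1 ≤ P → HasLaw (fun ω => c (Z' P ω)) (realGaussian σ) Pr) (b : ℝ) :
    Subalgebra ℂ (E → ℂ) where
  carrier := {f | f ∈ algebraicFun c ∧
    IsClose Pr b (fun p => f (Z p.1 p.2)) (fun p => f (Z' p.1 p.2))}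
  mul_mem' := fun ha hb => ⟨mul_mem ha.1 hb.1, ha.2.mul hb.2
    (isSubpoly_of_mem_algebraicFun hZ ha.1) (isSubpoly_of_mem_algebraicFun hZ' hb.1)⟩
  add_mem' := fun ha hb => ⟨add_mem ha.1 hb.1, ha.2.add hb.2⟩
  algebraMap_mem' a := ⟨Subalgebra.algebraMap_mem _ a, IsClose.refl⟩

theorem isArithClosed_closeFun
    (hZ : ∀ P, 1 ≤ P → HasLaw (fun ω => c (Z P ω)) (realGaussian σ) Pr)
    (hZ' : ∀ P, 1 ≤ P → HasLaw (fun ω => c (Z' P ω)) (realGaussian σ) Pr) {b : ℝ} (hb : 0 < b) :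
    IsArithClosed (closeFun hZ hZ' b) where
  star_mem h := ⟨(isArithClosed_algebraicFun c).star_mem h.1, h.2.conj⟩
  inv_mem h := ⟨(isArithClosed_algebraicFun c).inv_mem h.1, h.2.inv hb
    (isAwayFromZero_of_mem_algebraicFun hZ h.1) (isAwayFromZero_of_mem_algebraicFun hZ' h.1)⟩
  sqrt_mem h0 h := by
    have hs := (isArithClosed_algebraicFun c).sqrt_mem h0 h.1
    exact ⟨hs, h.2.sqrt (fun _ => h0 _) (fun _ => h0 _)
      (isAwayFromZero_of_mem_algebraicFun hZ hs) (isAwayFromZero_of_mem_algebraicFun hZ' hs)⟩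

end Algebraic

/-! ### The law of the channel and of its estimates -/

instance : IsProbabilityMeasure stdComplexNormal :=
  Measure.isProbabilityMeasure_map Complex.measurableEquivRealProd.symm.measurable.aemeasurable

instance {K M : ℕ} {N : Fin M → ℕ} : IsProbabilityMeasure (channelLaw K N) :=
  inferInstanceAs (IsProbabilityMeasure (Measure.pi fun _ : Fin K => Measure.pi fun _ : Ant N =>
    stdComplexNormal))

/-- A pair of vectors, rotated by the angle `θ`. -/
noncomputable def rotate {E : Type*} [AddCommGroup E] [Module ℂ E] (θ : ℝ) (p : E × E) : E × E :=
  (((Real.cos θ : ℝ) : ℂ) • p.1 + ((Real.sin θ : ℝ) : ℂ) • p.2,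
    ((Real.cos θ : ℝ) : ℂ) • p.2 - ((Real.sin θ : ℝ) : ℂ) • p.1)

theorem measurePreserving_rotate_pi {ι E : Type*} [Fintype ι] [AddCommGroup E] [Module ℂ E]
    [MeasurableSpace E] {ν : Measure E} [IsProbabilityMeasure ν] {θ : ℝ}
    (h : MeasurePreserving (rotate θ) (ν.prod ν) (ν.prod ν)) :
    MeasurePreserving (rotate (E := ι → E) θ)
      ((Measure.pi fun _ : ι => ν).prod (Measure.pi fun _ : ι => ν))
      ((Measure.pi fun _ : ι => ν).prod (Measure.pi fun _ : ι => ν)) := by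
  have h1 := measurePreserving_arrowProdEquivProdArrow E E ι (fun _ => ν) (fun _ => ν)
  exact (h1.comp (measurePreserving_pi _ _ fun _ : ι => h)).comp (h1.symm _)

theorem measurePreserving_rotate_stdComplexNormal (θ : ℝ) :
    MeasurePreserving (rotate θ) (stdComplexNormal.prod stdComplexNormal)
      (stdComplexNormal.prod stdComplexNormal) := by
  have hg : IsGaussian stdComplexNormal :=
    isGaussian_map_equiv (μ := (gaussianReal 0 (1 / 2)).prod (gaussianReal 0 (1 / 2)))
      Complex.equivRealProdCLM.symm
  have hmeas : AEMeasurable Complex.measurableEquivRealProd.symm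
      ((gaussianReal 0 (1 / 2)).prod (gaussianReal 0 (1 / 2))) :=
    Complex.measurableEquivRealProd.symm.measurable.aemeasurable
  have hint : Integrable (fun z : ℂ => z) stdComplexNormal := IsGaussian.integrable_id
  have hmean : ∫ z, id z ∂stdComplexNormal = 0 := by
    apply Complex.ext
    · have h1 := Complex.reCLM.integral_comp_comm hint
      simp only [Complex.reCLM_apply] at h1
      rw [Complex.zero_re]
      refine h1.symm.trans ?_
      rw [stdComplexNormal, integral_map hmeas (by fun_prop)]
      exact (integral_fun_fst (μ := gaussianReal 0 (1 / 2)) (ν := gaussianReal 0 (1 / 2))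
        (fun x : ℝ => x)).trans (by simp)
    · have h1 := Complex.imCLM.integral_comp_comm hint
      simp only [Complex.imCLM_apply] at h1
      rw [Complex.zero_im]
      refine h1.symm.trans ?_
      rw [stdComplexNormal, integral_map hmeas (by fun_prop)]
      exact (integral_fun_snd (μ := gaussianReal 0 (1 / 2)) (ν := gaussianReal 0 (1 / 2))
        (fun x : ℝ => x)).trans (by simp)
  have h := IsGaussian.map_rotation_eq_self (μ := stdComplexNormal) hmean θ
  have he : (rotate θ : ℂ × ℂ → ℂ × ℂ) = ContinuousLinearMap.rotation θ := by
    funext p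
    rw [ContinuousLinearMap.rotation_apply, rotate]
    simp only [Complex.real_smul, smul_eq_mul, Prod.mk.injEq, true_and]
    push_cast
    ring
  rw [he]
  exact ⟨(ContinuousLinearMap.rotation θ).continuous.measurable, h⟩

section Channel

variable {K M : ℕ} {N : Fin M → ℕ}

/-- The rotation invariance of the Gaussian law makes the estimate of a TX independent of the
matrix that completes it to a rotation of channel and noise. -/
theorem measurePreserving_rotate_channelLaw (θ : ℝ) :
    MeasurePreserving (rotate (E := Channel K N) θ)
      ((channelLaw K N).prod (channelLaw K N)) ((channelLaw K N).prod (channelLaw K N)) :=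
  measurePreserving_rotate_pi (measurePreserving_rotate_pi
    (measurePreserving_rotate_stdComplexNormal θ))

variable (K N) in
/-- The real and imaginary parts of the entries of a channel matrix. -/
abbrev Coord : Type := (Fin K × Ant N) × Bool

/-- The real coordinates of a channel matrix: `true` stands for the real and `false` for the
imaginary part of an entry. -/
def coord (G : Channel K N) (s : Coord K N) : ℝ :=
  if s.2 then (G s.1.1 s.1.2).re else (G s.1.1 s.1.2).im

theorem measurable_entry (i : Fin K) (a : Ant N) : Measurable fun G : Channel K N => G i a :=
  (measurable_pi_apply a).comp (measurable_pi_apply i)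

theorem measurable_coord : Measurable (coord (K := K) (N := N)) := by
  refine measurable_pi_iff.2 fun s => ?_
  unfold coord
  split_ifs
  · exact Complex.measurable_re.comp (measurable_entry _ _)
  · exact Complex.measurable_im.comp (measurable_entry _ _)

theorem measurePreserving_coord :
    MeasurePreserving coord (channelLaw K N) (realGaussian (Coord K N)) := by
  refine ⟨measurable_coord, Eq.symm (Measure.pi_eq fun s hs => ?_)⟩
  rw [Measure.map_apply measurable_coord (MeasurableSet.univ_pi hs)]
  have hpre : coord (K := K) (N := N) ⁻¹' (Set.univ.pi s) = Set.univ.pi fun i =>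
      Set.univ.pi fun a => {z : ℂ | z.re ∈ s ((i, a), true) ∧ z.im ∈ s ((i, a), false)} := by
    ext G
    constructor
    · intro h i _ a _
      exact ⟨by simpa [coord] using h ((i, a), true) trivial,
        by simpa [coord] using h ((i, a), false) trivial⟩
    · rintro h ⟨⟨i, a⟩, b⟩ _
      have := h i trivial a trivial
      cases b
      · simpa [coord] using this.2
      · simpa [coord] using this.1
  rw [hpre]
  refine (Measure.pi_pi (fun _ : Fin K => Measure.pi fun _ : Ant N => stdComplexNormal) _).trans ?_
  simp_rw [Measure.pi_pi]
  rw [Fintype.prod_prod_type, Fintype.prod_prod_type]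
  refine Finset.prod_congr rfl fun i _ => Finset.prod_congr rfl fun a _ => ?_
  rw [stdComplexNormal, MeasurableEquiv.map_apply]
  have : Complex.measurableEquivRealProd.symm ⁻¹'
      {z : ℂ | z.re ∈ s ((i, a), true) ∧ z.im ∈ s ((i, a), false)}
      = s ((i, a), true) ×ˢ s ((i, a), false) := by
    ext p; simp [Complex.measurableEquivRealProd]
  rw [this, Measure.prod_prod, Fintype.prod_bool]

/-- The real coordinates of a pair of channel matrices. -/
def pairCoord (p : Channel K N × Channel K N) : Coord K N ⊕ Coord K N → ℝ :=
  Sum.elim (coord p.1) (coord p.2)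

theorem measurePreserving_pairCoord :
    MeasurePreserving pairCoord ((channelLaw K N).prod (channelLaw K N))
      (realGaussian (Coord K N ⊕ Coord K N)) := by
  have h := (measurePreserving_sumPiEquivProdPi_symm
    (fun _ : Coord K N ⊕ Coord K N => gaussianReal 0 (1 / 2))).comp
    (measurePreserving_coord.prod measurePreserving_coord (μa := channelLaw K N)
      (μc := channelLaw K N))
  convert h using 1
  funext p s
  rcases s with s | s <;> rfl

theorem entry_mem_of_coord_mem {X : Type*} {S : Subalgebra ℂ (X → ℂ)} {g : X → Channel K N}
    (h : ∀ s, (fun x => (coord (g x) s : ℂ)) ∈ S) (i : Fin K) (a : Ant N) :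
    (fun x => g x i a) ∈ S :=
  re_im_mem (by simpa [coord] using h ((i, a), true)) (by simpa [coord] using h ((i, a), false))

theorem entry_mem_algebraicFun (i : Fin K) (a : Ant N) :
    (fun G : Channel K N => G i a) ∈ algebraicFun (coord (K := K) (N := N)) :=
  entry_mem_of_coord_mem coord_mem_algebraicFun i a

/-- The weight of the noise in the estimate with accuracy exponent `a` at SNR `P`. -/
noncomputable def noiseWeight (P a : ℝ) : ℝ := √P ^ (-a)

/-- The weight of the channel in the estimate with accuracy exponent `a` at SNR `P`. -/
noncomputable def channelWeight (P a : ℝ) : ℝ := √(1 - noiseWeight P a ^ 2)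

/-- The matrix that completes the estimate to a rotation of the channel and the noise. -/
noncomputable def complement (P a : ℝ) (H Δ : Channel K N) : Channel K N :=
  (channelWeight P a : ℂ) • Δ - (noiseWeight P a : ℂ) • H

theorem noiseWeight_eq_rpow {P : ℝ} (hP : 0 ≤ P) (a : ℝ) : noiseWeight P a = P ^ (-(a / 2)) := by
  rw [noiseWeight, Real.sqrt_eq_rpow, ← Real.rpow_mul hP]
  congr 1; ring

theorem noiseWeight_nonneg (P a : ℝ) : 0 ≤ noiseWeight P a :=
  Real.rpow_nonneg (Real.sqrt_nonneg _) _

theorem noiseWeight_le_one {P a : ℝ} (hP : 1 ≤ P) (ha : 0 ≤ a) : noiseWeight P a ≤ 1 :=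
  Real.rpow_le_one_of_one_le_of_nonpos (Real.one_le_sqrt.2 hP) (neg_nonpos.2 ha)

theorem channelWeight_nonneg (P a : ℝ) : 0 ≤ channelWeight P a := Real.sqrt_nonneg _

theorem channelWeight_sq {P a : ℝ} (hP : 1 ≤ P) (ha : 0 ≤ a) :
    channelWeight P a ^ 2 = 1 - noiseWeight P a ^ 2 := by
  refine Real.sq_sqrt (sub_nonneg.2 ?_)
  exact pow_le_one₀ (noiseWeight_nonneg P a) (noiseWeight_le_one hP ha)

theorem estimate_eq (P a : ℝ) (H Δ : Channel K N) :
    estimate P a H Δ = (channelWeight P a : ℂ) • H + (noiseWeight P a : ℂ) • Δ := rfl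

theorem rotate_eq_estimate {P a : ℝ} (hP : 1 ≤ P) (ha : 0 ≤ a) (H Δ : Channel K N) :
    rotate (Real.arcsin (noiseWeight P a)) (H, Δ) = (estimate P a H Δ, complement P a H Δ) := by
  have h0 := noiseWeight_nonneg P a
  rw [rotate, Real.cos_arcsin, Real.sin_arcsin (by linarith) (noiseWeight_le_one hP ha)]
  rfl

theorem channel_eq_estimate_sub_complement {P a : ℝ} (hP : 1 ≤ P) (ha : 0 ≤ a)
    (H Δ : Channel K N) : H = (channelWeight P a : ℂ) • estimate P a H Δ
      - (noiseWeight P a : ℂ) • complement P a H Δ := by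
  have h : (channelWeight P a : ℂ) ^ 2 = 1 - (noiseWeight P a : ℂ) ^ 2 := by
    exact_mod_cast channelWeight_sq hP ha
  ext i j
  simp only [estimate_eq, complement, Matrix.sub_apply, Matrix.smul_apply, Matrix.add_apply,
    smul_eq_mul]
  linear_combination (-H i j) * h

variable {Ω : Type*} [MeasurableSpace Ω] {Pr : Measure Ω} [IsProbabilityMeasure Pr]
  {H : Ω → Channel K N} {Δ : Fin M → Ω → Channel K N}

theorem IsCSITModel.hasLaw_estimate_complement (h : IsCSITModel Pr H Δ) (j : Fin M) {P a : ℝ}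
    (hP : 1 ≤ P) (ha : 0 ≤ a) :
    HasLaw (fun ω => (estimate P a (H ω) (Δ j ω), complement P a (H ω) (Δ j ω)))
      ((channelLaw K N).prod (channelLaw K N)) Pr := by
  have h1 := (indepFun_iff_hasLaw_prodMk_prod h.channel (h.noise j)).1 (h.indep j)
  have h2 := (measurePreserving_rotate_channelLaw (Real.arcsin (noiseWeight P a))).fun_comp_hasLaw
    h1
  simpa only [rotate_eq_estimate hP ha] using h2

theorem IsCSITModel.hasLaw_estimate (h : IsCSITModel Pr H Δ) (j : Fin M) {P a : ℝ}
    (hP : 1 ≤ P) (ha : 0 ≤ a) :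
    HasLaw (fun ω => estimate P a (H ω) (Δ j ω)) (channelLaw K N) Pr :=
  measurePreserving_fst.fun_comp_hasLaw (h.hasLaw_estimate_complement j hP ha)

end Channel

/-! ### Measurability of algebraic maps -/

/-- The measurable complex-valued functions. -/
def measurableFun (X : Type*) [MeasurableSpace X] : Subalgebra ℂ (X → ℂ) where
  carrier := {f | Measurable f}
  mul_mem' := Measurable.mul
  add_mem' := Measurable.add
  algebraMap_mem' _ := measurable_const

theorem isArithClosed_measurableFun (X : Type*) [MeasurableSpace X] :
    IsArithClosed (measurableFun X) where
  star_mem h := Complex.continuous_conj.measurable.comp h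
  inv_mem h := Measurable.inv h
  sqrt_mem {f} _ h := by
    have h1 : Measurable f := by
      have := Complex.measurable_re.comp (show Measurable fun x => (f x : ℂ) from h)
      simpa [Function.comp_def] using this
    exact Complex.measurable_ofReal.comp h1.sqrt

theorem measurable_matrix {X m n : Type*} [MeasurableSpace X] {f : X → Matrix m n ℂ}
    (h : ∀ i j, Measurable fun x => f x i j) : Measurable f :=
  measurable_pi_iff.2 fun i => measurable_pi_iff.2 fun j => h i j

theorem measurable_matrix_apply {m n : Type*} (i : m) (j : n) :
    Measurable fun A : Matrix m n ℂ => A i j :=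
  (measurable_pi_apply j).comp (measurable_pi_apply i)

section Scheme

variable {K M : ℕ} {N : Fin M → ℕ} {V : Channel K N → Precoder N K}

theorem IsZFScheme.measurable (hV : IsZFScheme V) : Measurable V :=
  measurable_matrix ((isArithClosed_measurableFun _).algebraicMap_mem
    (fun i a => measurable_entry i a) hV.algebraic)

theorem IsZFScheme.entry_mem_algebraicFun (hV : IsZFScheme V) (a : Ant N) (i : Fin K) :
    (fun G => V G a i) ∈ algebraicFun (coord (K := K) (N := N)) :=
  (isArithClosed_algebraicFun _).algebraicMap_mem NetworkMISO.entry_mem_algebraicFun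
    hV.algebraic a i

/-! ### Events of probability one for Gaussian channel matrices -/

/-- The variable that stands for an entry of a channel matrix, as a polynomial in the real
coordinates. -/
noncomputable def entryPoly (i : Fin K) (a : Ant N) : MvPolynomial (Coord K N) ℂ :=
  MvPolynomial.X ((i, a), true) + MvPolynomial.C Complex.I * MvPolynomial.X ((i, a), false)

theorem polyEval_entryPoly (i : Fin K) (a : Ant N) (G : Channel K N) :
    polyEval coord (entryPoly i a) G = G i a := by
  rw [polyEval_apply]
  simp only [entryPoly, map_add, map_mul, MvPolynomial.eval_X, MvPolynomial.eval_C, coord]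
  simpa [mul_comm] using Complex.re_add_im (G i a)

theorem ae_polyEval_coord_ne_zero {Q : MvPolynomial (Coord K N) ℂ}
    (hQ : ∃ G, polyEval coord Q G ≠ 0) :
    ∀ᵐ G ∂(channelLaw K N), polyEval coord Q G ≠ 0 := by
  obtain ⟨G, hG⟩ := hQ
  have hQ0 : Q ≠ 0 := by
    rintro rfl
    exact hG (by simp)
  have h := ae_eval_ne_zero hQ0
  rw [← measurePreserving_coord.map_eq] at h
  exact ae_of_ae_map measurable_coord.aemeasurable h

/-- A nonzero linear form of a row of a Gaussian channel matrix does not vanish. -/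
theorem ae_dotProduct_ne_zero {v : Ant N → ℂ} (hv : v ≠ 0) (i : Fin K) :
    ∀ᵐ D ∂(channelLaw K N), ∑ a, D i a * v a ≠ 0 := by
  have hev : ∀ D : Channel K N,
      polyEval coord (∑ a, entryPoly i a * MvPolynomial.C (v a)) D = ∑ a, D i a * v a := by
    intro D
    rw [map_sum, Finset.sum_apply]
    refine Finset.sum_congr rfl fun a _ => ?_
    rw [map_mul, Pi.mul_apply, polyEval_entryPoly, polyEval_apply, MvPolynomial.eval_C]
  simp_rw [← hev]
  refine ae_polyEval_coord_ne_zero ?_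
  obtain ⟨a, ha⟩ := Function.ne_iff.1 hv
  refine ⟨Matrix.of fun _ b => if b = a then 1 else 0, ?_⟩
  rw [hev]
  simpa using ha

theorem mul_pinv_eq_one {m n : Type*} [Fintype m] [Fintype n] [DecidableEq m]
    {A : Matrix m n ℂ} {R : Matrix n m ℂ} (h : A * R = 1) : A * pinv A = 1 := by
  calc A * pinv A = A * pinv A * (A * R) := by rw [h, Matrix.mul_one]
    _ = A * pinv A * A * R := by simp only [Matrix.mul_assoc]
    _ = 1 := by rw [(pinv_spec A).mul_mul_self, h]

/-- As TX `0` has at least `K - 1` antennas, it can almost surely prescribe the interference of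
a symbol at the `K - 1` unintended RXs. -/
theorem ae_ownBlock_mul_pinv [NeZero M] (hN : K ≤ N 0 + 1) :
    ∀ᵐ G ∂(channelLaw K N), ∀ ℓ, ownBlock G ℓ * pinv (ownBlock G ℓ) = 1 := by
  refine ae_all_iff.2 fun ℓ => ?_
  obtain ⟨e₀⟩ : Nonempty ({i : Fin K // i ≠ ℓ} ↪ Fin (N 0)) := by
    refine Function.Embedding.nonempty_of_card_le ?_
    simp only [ne_eq, Fintype.card_subtype_compl, Fintype.card_fin,
      Fintype.card_subtype_eq]
    omega
  let e : {i : Fin K // i ≠ ℓ} → {a : Ant N // a.1 = 0} := fun i => ⟨⟨0, e₀ i⟩, rfl⟩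
  have he : Function.Injective e := by
    intro i j hij
    have : (⟨0, e₀ i⟩ : Ant N) = ⟨0, e₀ j⟩ := congrArg Subtype.val hij
    exact e₀.injective (by simpa using this)
  -- the minor of the columns selected by `e`; it is `1` at a suitable matrix of zeros and ones
  let Q : MvPolynomial (Coord K N) ℂ :=
    (Matrix.of fun i j : {i : Fin K // i ≠ ℓ} => entryPoly i.1 (e j).1).det
  have hev : ∀ G : Channel K N,
      polyEval coord Q G = ((ownBlock G ℓ).submatrix id e).det := by
    intro G
    let φ : MvPolynomial (Coord K N) ℂ →+* ℂ :=
      (Pi.evalRingHom (fun _ : Channel K N => ℂ) G).comp (polyEval coord)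
    have h1 : polyEval coord Q G = φ Q := rfl
    rw [h1, RingHom.map_det]
    congr 1
    ext i j
    exact polyEval_entryPoly _ _ _
  have hne : ∀ᵐ G ∂(channelLaw K N), polyEval coord Q G ≠ 0 := by
    classical
    refine ae_polyEval_coord_ne_zero
      ⟨Matrix.of fun i a => if ∃ h : i ≠ ℓ, a = (e ⟨i, h⟩).1 then 1 else 0, ?_⟩
    rw [hev]
    have : (ownBlock (Matrix.of fun i a => if ∃ h : i ≠ ℓ, a = (e ⟨i, h⟩).1 then (1 : ℂ) else 0)
        ℓ).submatrix id e = 1 := by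
      ext i j
      simp only [ownBlock, Matrix.submatrix_apply, id, Matrix.of_apply, Matrix.one_apply]
      congr 1
      rw [eq_iff_iff]
      constructor
      · rintro ⟨_, h⟩
        exact (he (Subtype.ext h)).symm
      · rintro rfl
        exact ⟨i.2, rfl⟩
    rw [this, Matrix.det_one]
    exact one_ne_zero
  filter_upwards [hne] with G hG
  classical
  rw [hev] at hG
  have hsub : (ownBlock G ℓ).submatrix id e
      = ownBlock G ℓ * Matrix.of fun a j => if a = e j then (1 : ℂ) else 0 := by
    ext i j
    simp [Matrix.mul_apply]
  refine mul_pinv_eq_one (R := (Matrix.of fun a j => if a = e j then (1 : ℂ) else 0)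
    * ((ownBlock G ℓ).submatrix id e)⁻¹) ?_
  rw [← Matrix.mul_assoc, ← hsub, Matrix.mul_nonsing_inv _ (isUnit_iff_ne_zero.2 hG)]

/-! ### Closeness of the estimates and of the centralized precoders -/

variable {Ω : Type*} [MeasurableSpace Ω] {Pr : Measure Ω} [IsProbabilityMeasure Pr]
  {H : Ω → Channel K N} {Δ : Fin M → Ω → Channel K N}

theorem isSubpoly_entry {X : Ω → Channel K N} (hX : HasLaw X (channelLaw K N) Pr)
    (i : Fin K) (a : Ant N) : IsSubpoly Pr fun p => X p.2 i a :=
  isSubpoly_of_mem_algebraicFun (c := coord) (Z := fun _ => X)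
    (fun _ _ => measurePreserving_coord.fun_comp_hasLaw hX) (entry_mem_algebraicFun i a)

theorem isClose_noiseWeight (a : ℝ) :
    IsClose Pr (a / 2) (fun p => (noiseWeight p.1 a : ℂ)) 0 := fun β hβ => by
  filter_upwards [tendsto_fst_whp.eventually (eventually_ge_atTop 1)] with p hp
  rw [Pi.zero_apply, sub_zero, Complex.norm_real, Real.norm_of_nonneg (noiseWeight_nonneg _ _),
    noiseWeight_eq_rpow (by linarith)]
  exact Real.rpow_le_rpow_of_exponent_le hp (by linarith)

theorem isClose_channelWeight {a : ℝ} (ha : 0 ≤ a) :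
    IsClose Pr (a / 2) (fun p => (channelWeight p.1 a - 1 : ℂ)) 0 := fun β hβ => by
  filter_upwards [isClose_noiseWeight (Pr := Pr) a β hβ,
    tendsto_fst_whp.eventually (eventually_ge_atTop 1)] with p h hp
  refine le_trans ?_ h
  have h0 := noiseWeight_nonneg p.1 a
  have h1 := noiseWeight_le_one hp ha
  have h2 := channelWeight_nonneg p.1 a
  have h3 := channelWeight_sq hp ha
  rw [Pi.zero_apply, sub_zero, sub_zero, Complex.norm_real, Real.norm_of_nonneg h0,
    ← Complex.ofReal_one, ← Complex.ofReal_sub, Complex.norm_real, Real.norm_eq_abs, abs_le]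
  constructor <;> nlinarith

theorem IsCSITModel.isClose_estimate_channel (h : IsCSITModel Pr H Δ) (j : Fin M) {α : ℝ}
    (hα : 0 ≤ α) (i : Fin K) (a : Ant N) :
    IsClose Pr (α / 2) (fun p => estimate p.1 α (H p.2) (Δ j p.2) i a) fun p => H p.2 i a := by
  have h1 := IsClose.mul_zero_of_subpoly (isSubpoly_entry h.channel i a)
    (isClose_channelWeight (Pr := Pr) hα)
  have h2 := IsClose.mul_zero_of_subpoly (isSubpoly_entry (h.noise j) i a)
    (isClose_noiseWeight (Pr := Pr) α)
  refine IsClose.sub_zero_iff.1 ?_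
  convert h1.add h2 using 1
  · funext p
    simp only [estimate_eq, Matrix.add_apply, Matrix.smul_apply, smul_eq_mul]
    ring
  · funext p; simp

theorem IsCSITModel.hasLaw_coord_estimate (h : IsCSITModel Pr H Δ) (j : Fin M) {α : ℝ}
    (hα : 0 ≤ α) (P : ℝ) (hP : 1 ≤ P) :
    HasLaw (fun ω => coord (estimate P α (H ω) (Δ j ω))) (realGaussian (Coord K N)) Pr :=
  measurePreserving_coord.fun_comp_hasLaw (h.hasLaw_estimate j hP hα)

theorem IsCSITModel.hasLaw_pairCoord (h : IsCSITModel Pr H Δ) (j : Fin M) {α : ℝ}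
    (hα : 0 ≤ α) (P : ℝ) (hP : 1 ≤ P) :
    HasLaw (fun ω => pairCoord (estimate P α (H ω) (Δ j ω), complement P α (H ω) (Δ j ω)))
      (realGaussian (Coord K N ⊕ Coord K N)) Pr :=
  measurePreserving_pairCoord.fun_comp_hasLaw (h.hasLaw_estimate_complement j hP hα)

/-- The centralized precoders that two TXs compute differ essentially as much as their
estimates do. -/
theorem IsZFScheme.isClose (hV : IsZFScheme V) (h : IsCSITModel Pr H Δ) {j k : Fin M}
    {α β b : ℝ} (hb : 0 < b) (hα : b ≤ α / 2) (hβ : b ≤ β / 2) (a : Ant N) (i : Fin K) :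
    IsClose Pr b (fun p => V (estimate p.1 α (H p.2) (Δ j p.2)) a i)
      (fun p => V (estimate p.1 β (H p.2) (Δ k p.2)) a i) := by
  have hα0 : 0 ≤ α := by linarith
  have hβ0 : 0 ≤ β := by linarith
  have hclosed := isArithClosed_closeFun (h.hasLaw_coord_estimate j hα0)
    (h.hasLaw_coord_estimate k hβ0) hb
  refine (hclosed.algebraicMap_mem (ρ := fun G => G) (fun i a => ?_) hV.algebraic a i).2
  exact ⟨NetworkMISO.entry_mem_algebraicFun i a,
    ((h.isClose_estimate_channel j hα0 i a).of_le hα).trans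
      ((h.isClose_estimate_channel k hβ0 i a).of_le hβ).symm⟩

/-! ### Lower bounds for the useful signal and the interference -/

/-- The signal that RX `i` would receive over the estimated channel is not tiny. -/
theorem IsZFScheme.eventually_le_norm_signal (hV : IsZFScheme V)
    (hsignal : ∀ᵐ G ∂(channelLaw K N), ∀ i, (G * V G) i i ≠ 0) (h : IsCSITModel Pr H Δ)
    (j : Fin M) {α : ℝ} (hα : 0 ≤ α) {ε : ℝ} (hε : 0 < ε) (i : Fin K) :
    ∀ᶠ p in whp Pr, p.1 ^ (-ε) ≤ ‖(estimate p.1 α (H p.2) (Δ j p.2)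
      * V (estimate p.1 α (H p.2) (Δ j p.2))) i i‖ := by
  have hmem : (fun G : Channel K N => (G * V G) i i) ∈ algebraicFun (coord (K := K) (N := N)) :=
    IsArithClosed.matrix_mul_mem (fun i a => NetworkMISO.entry_mem_algebraicFun i a)
      hV.entry_mem_algebraicFun i i
  have hae : ∀ᶠ p in whp Pr, (estimate p.1 α (H p.2) (Δ j p.2)
      * V (estimate p.1 α (H p.2) (Δ j p.2))) i i ≠ 0 := by
    refine eventually_whp_of_ae ?_
    filter_upwards [eventually_ge_atTop 1] with P hP
    have hl := h.hasLaw_estimate j hP hα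
    rw [← hl.map_eq] at hsignal
    filter_upwards [ae_of_ae_map hl.aemeasurable hsignal] with ω hω using hω i
  filter_upwards [isAwayFromZero_of_mem_algebraicFun (h.hasLaw_coord_estimate j hα) hmem ε hε, hae]
    with p h1 h2 using h1.resolve_left h2

/-- For `ℓ ≠ i` this quantity is, up to the noise weight, the interference that symbol `ℓ` causes at
RX `i`. It is an algebraic function of a Gaussian pair, and almost surely nonzero because the
complement is independent of the precoder. -/
theorem IsZFScheme.eventually_le_norm_complement (hV : IsZFScheme V)
    (hsignal : ∀ᵐ G ∂(channelLaw K N), ∀ i, (G * V G) i i ≠ 0) (h : IsCSITModel Pr H Δ)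
    (j : Fin M) {α : ℝ} (hα : 0 ≤ α) {ε : ℝ} (hε : 0 < ε) (i ℓ : Fin K) :
    ∀ᶠ p in whp Pr, p.1 ^ (-ε) ≤ ‖(complement p.1 α (H p.2) (Δ j p.2)
      * V (estimate p.1 α (H p.2) (Δ j p.2))) i ℓ‖ := by
  set f : Channel K N × Channel K N → ℂ := fun q => (q.2 * V q.1) i ℓ with hf
  have hfst : ∀ (i : Fin K) (a : Ant N), (fun q : Channel K N × Channel K N => q.1 i a)
      ∈ algebraicFun (pairCoord (K := K) (N := N)) :=
    entry_mem_of_coord_mem fun s => coord_mem_algebraicFun (c := pairCoord) (Sum.inl s)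
  have hsnd : ∀ (i : Fin K) (a : Ant N), (fun q : Channel K N × Channel K N => q.2 i a)
      ∈ algebraicFun (pairCoord (K := K) (N := N)) :=
    entry_mem_of_coord_mem fun s => coord_mem_algebraicFun (c := pairCoord) (Sum.inr s)
  have hmem : f ∈ algebraicFun (pairCoord (K := K) (N := N)) :=
    IsArithClosed.matrix_mul_mem hsnd
      ((isArithClosed_algebraicFun _).algebraicMap_mem hfst hV.algebraic) i ℓ
  have hfm : Measurable f :=
    IsArithClosed.matrix_mul_mem (S := measurableFun (Channel K N × Channel K N))
      (fun i a => (measurable_entry i a).comp measurable_snd)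
      (fun a l => (measurable_matrix_apply a l).comp (hV.measurable.comp measurable_fst)) i ℓ
  have hnull : ∀ᵐ q ∂((channelLaw K N).prod (channelLaw K N)), f q ≠ 0 := by
    refine (Measure.ae_prod_iff_ae_ae (p := fun q => f q ≠ 0)
      (hfm (measurableSet_singleton (0 : ℂ)).compl)).2 ?_
    filter_upwards [hsignal] with G hG
    refine ae_dotProduct_ne_zero (v := fun a => V G a ℓ) (fun h0 => hG ℓ ?_) i
    rw [Matrix.mul_apply]
    exact Finset.sum_eq_zero fun a _ => by rw [show V G a ℓ = 0 from congrFun h0 a, mul_zero]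
  have hae : ∀ᶠ p in whp Pr, (complement p.1 α (H p.2) (Δ j p.2)
      * V (estimate p.1 α (H p.2) (Δ j p.2))) i ℓ ≠ 0 := by
    refine eventually_whp_of_ae ?_
    filter_upwards [eventually_ge_atTop 1] with P hP
    have hl := h.hasLaw_estimate_complement j hP hα
    rw [← hl.map_eq] at hnull
    exact ae_of_ae_map hl.aemeasurable hnull
  filter_upwards [isAwayFromZero_of_mem_algebraicFun (h.hasLaw_pairCoord j hα) hmem ε hε, hae]
    with p h1 h2 using h1.resolve_left h2

end Scheme

/-! ### Euclidean norms of finite families -/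

/-- The Euclidean norm of the subfamily of `x` indexed by `s`. -/
noncomputable def l2Norm {ι : Type*} (s : Finset ι) (x : ι → ℂ) : ℝ := √(∑ i ∈ s, ‖x i‖ ^ 2)

section L2

variable {ι : Type*} (s : Finset ι) (x y : ι → ℂ)

theorem l2Norm_nonneg : 0 ≤ l2Norm s x := Real.sqrt_nonneg _

theorem l2Norm_sq : l2Norm s x ^ 2 = ∑ i ∈ s, ‖x i‖ ^ 2 :=
  Real.sq_sqrt (Finset.sum_nonneg fun _ _ => by positivity)

theorem l2Norm_eq : l2Norm s x = ‖(WithLp.toLp 2 fun i : s => x i : EuclideanSpace ℂ s)‖ := by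
  rw [EuclideanSpace.norm_eq, l2Norm, ← Finset.sum_coe_sort s]

variable {s} in
theorem norm_le_l2Norm {i : ι} (hi : i ∈ s) : ‖x i‖ ≤ l2Norm s x := by
  refine Real.le_sqrt_of_sq_le ?_
  exact Finset.single_le_sum (f := fun i => ‖x i‖ ^ 2) (fun _ _ => by positivity) hi

theorem l2Norm_le_sum : l2Norm s x ≤ ∑ i ∈ s, ‖x i‖ := by
  refine Real.sqrt_le_iff.2 ⟨Finset.sum_nonneg fun _ _ => norm_nonneg _, ?_⟩
  exact Finset.sum_sq_le_sq_sum_of_nonneg fun _ _ => norm_nonneg _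

theorem abs_l2Norm_sub_le : |l2Norm s x - l2Norm s y| ≤ ∑ i ∈ s, ‖x i - y i‖ := by
  refine le_trans ?_ (l2Norm_le_sum s fun i => x i - y i)
  simp only [l2Norm_eq]
  exact abs_norm_sub_norm_le _ _

end L2

theorem rowNorm_eq_l2Norm {ι : Type*} {K : ℕ} (T : Matrix ι (Fin K) ℂ) (a : ι) :
    rowNorm T a = l2Norm Finset.univ (T a) := rfl

theorem norm_entry_le_rowNorm {ι : Type*} {K : ℕ} (T : Matrix ι (Fin K) ℂ) (a : ι) (i : Fin K) :
    ‖T a i‖ ≤ rowNorm T a :=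
  norm_le_l2Norm (T a) (Finset.mem_univ i)

/-! ### The decentralized precoder -/

section Decentralized

variable {K M : ℕ} [NeZero M] {N : Fin M → ℕ} {V : Channel K N → Precoder N K}

/-- The global precoder that results from the estimates `G` when TX `0` corrects the interference
of the others, without back-off and regardless of the power constraint. -/
noncomputable def corrected (V : Channel K N → Precoder N K) (G : Fin M → Channel K N) :
    Precoder N K :=
  Matrix.of fun a ℓ => V (G a.1) a ℓ +
    if h : a.1 = 0 then correction V (hierInfo G 0) ℓ ⟨a, h⟩ else 0

theorem nominal_apply (V : Channel K N → Precoder N K) (μ : ℝ) (G : Fin M → Channel K N)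
    (j : Fin M) (n : Fin (N j)) (ℓ : Fin K) :
    nominal V μ j (hierInfo G j) n ℓ = (μ : ℂ) * corrected V G ⟨j, n⟩ ℓ := rfl

theorem correction_apply (V : Channel K N → Precoder N K) (I : HierInfo K N 0) (ℓ : Fin K)
    (a : {a : Ant N // a.1 = 0}) :
    correction V I ℓ a = ∑ i, pinv (ownBlock (I ⟨0, le_rfl⟩) ℓ) a i *
      ∑ c : {c : Ant N // c.1 ≠ 0}, I ⟨0, le_rfl⟩ i.1 c.1 *
        (V (I ⟨0, le_rfl⟩) c.1 ℓ - V (I ⟨c.1.1, Fin.zero_le _⟩) c.1 ℓ) := rfl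

theorem correction_hierInfo (V : Channel K N → Precoder N K) (G : Fin M → Channel K N)
    (ℓ : Fin K) (a : {a : Ant N // a.1 = 0}) :
    correction V (hierInfo G 0) ℓ a = ∑ i, pinv (ownBlock (G 0) ℓ) a i *
      ∑ c : {c : Ant N // c.1 ≠ 0}, G 0 i.1 c.1 * (V (G 0) c.1 ℓ - V (G c.1.1) c.1 ℓ) := rfl

theorem rowNorm_cdzf_le {μ : ℝ} {F : HierStrategy K N}
    (hF : ∀ j I n, rowNorm (F j I) n ≤ 1) (j : Fin M) (I : HierInfo K N j) (n : Fin (N j)) :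
    rowNorm (cdzf V μ F j I) n ≤ 1 := by
  unfold cdzf
  split_ifs with h
  · exact hF j I n
  · exact not_lt.1 fun hn => h ⟨n, hn⟩

theorem rowNorm_precoder_le {μ : ℝ} {F : HierStrategy K N}
    (hF : ∀ j I n, rowNorm (F j I) n ≤ 1) (G : Fin M → Channel K N) (a : Ant N) :
    rowNorm ((cdzf V μ F).precoder G) a ≤ 1 :=
  rowNorm_cdzf_le hF a.1 (hierInfo G a.1) a.2

/-- A deviation of at most `1 - μ` from a feasible row is compensated by the back-off, since
`μ (1 + (1 - μ)) ≤ 1`. -/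
theorem rowNorm_nominal_le (hV : IsZFScheme V) {μ : ℝ} (hμ : 0 ≤ μ)
    (G : Fin M → Channel K N) (j : Fin M) (n : Fin (N j))
    (h : ∑ ℓ, ‖corrected V G ⟨j, n⟩ ℓ - V (G j) ⟨j, n⟩ ℓ‖ ≤ 1 - μ) :
    rowNorm (nominal V μ j (hierInfo G j)) n ≤ 1 := by
  have h1 : rowNorm (nominal V μ j (hierInfo G j)) n
      = μ * l2Norm Finset.univ (corrected V G ⟨j, n⟩) := by
    simp only [rowNorm, nominal_apply, l2Norm, norm_mul, mul_pow, Complex.norm_real,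
      Real.norm_of_nonneg hμ]
    rw [← Finset.mul_sum, Real.sqrt_mul (by positivity), Real.sqrt_sq hμ]
  have h2 := abs_l2Norm_sub_le Finset.univ (corrected V G ⟨j, n⟩) (V (G j) ⟨j, n⟩)
  have h3 := hV.power (G j) ⟨j, n⟩
  rw [rowNorm_eq_l2Norm] at h3
  have h4 : l2Norm Finset.univ (corrected V G ⟨j, n⟩) ≤ 1 + (1 - μ) := by
    linarith [le_abs_self (l2Norm Finset.univ (corrected V G ⟨j, n⟩)
      - l2Norm Finset.univ (V (G j) ⟨j, n⟩))]
  rw [h1]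
  calc μ * l2Norm Finset.univ (corrected V G ⟨j, n⟩) ≤ μ * (1 + (1 - μ)) := by gcongr
    _ ≤ 1 := by nlinarith [sq_nonneg (1 - μ)]

/-- TXs that only scale down a feasible precoder are never in power outage. -/
theorem not_inOutage_of_ne_zero (hV : IsZFScheme V) {μ : ℝ} (hμ : 0 ≤ μ) (hμ1 : μ ≤ 1)
    (G : Fin M → Channel K N) {j : Fin M} (hj : j ≠ 0) :
    ¬ InOutage V μ j (hierInfo G j) := by
  rintro ⟨n, hn⟩
  refine absurd hn (not_lt.2 (rowNorm_nominal_le hV hμ G j n ?_))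
  simp [corrected, hj, hμ1]

theorem cdzf_eq_predicted (hV : IsZFScheme V) {μ : ℝ} (hμ : 0 ≤ μ) (hμ1 : μ ≤ 1)
    (F : HierStrategy K N) (G : Fin M → Channel K N) {j : Fin M} (hj : j ≠ 0) :
    cdzf V μ F j (hierInfo G j) = (μ : ℂ) • predicted V (hierInfo G 0) j := by
  rw [cdzf, if_neg (not_inOutage_of_ne_zero hV hμ hμ1 G hj)]
  ext n ℓ
  rw [nominal_apply]
  simp [corrected, hj, predicted, naive, hierInfo]

theorem precoder_eq_smul_corrected {μ : ℝ} {F : HierStrategy K N} {G : Fin M → Channel K N}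
    (h : ∀ j, ¬ InOutage V μ j (hierInfo G j)) :
    (cdzf V μ F).precoder G = (μ : ℂ) • corrected V G := by
  ext a ℓ
  simp only [HierStrategy.precoder, Matrix.of_apply, cdzf, if_neg (h a.1)]
  rfl

/-- Under the estimate of TX `0`, the corrected precoder causes the same interference as the
centralized one. -/
theorem mul_corrected_sub_eq_zero {G : Fin M → Channel K N} {i ℓ : Fin K} (hi : i ≠ ℓ)
    (h : ownBlock (G 0) ℓ * pinv (ownBlock (G 0) ℓ) = 1) :
    (G 0 * (corrected V G - V (G 0))) i ℓ = 0 := by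
  set u : {a : Ant N // a.1 ≠ 0} → ℂ := fun a => V (G 0) a.1 ℓ - V (G a.1.1) a.1 ℓ with hu
  have hcorr : ownBlock (G 0) ℓ *ᵥ correction V (hierInfo G 0) ℓ = otherBlock (G 0) ℓ *ᵥ u := by
    rw [correction, Matrix.mulVec_mulVec]
    change (ownBlock (G 0) ℓ * pinv (ownBlock (G 0) ℓ)) *ᵥ (otherBlock (G 0) ℓ *ᵥ u) = _
    rw [h, Matrix.one_mulVec]
  have h1 := congrFun hcorr ⟨i, hi⟩
  rw [Matrix.mul_apply, ← Fintype.sum_subtype_add_sum_subtype (fun a : Ant N => a.1 = 0)]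
  have e1 : ∑ a : {a : Ant N // a.1 = 0}, G 0 i a * (corrected V G - V (G 0)) a ℓ
      = (ownBlock (G 0) ℓ *ᵥ correction V (hierInfo G 0) ℓ) ⟨i, hi⟩ := by
    refine Finset.sum_congr rfl fun a _ => ?_
    rw [Matrix.sub_apply, corrected, Matrix.of_apply, dif_pos a.2, a.2, add_sub_cancel_left]
    rfl
  have e2 : ∑ a : {a : Ant N // ¬ a.1 = 0}, G 0 i a * (corrected V G - V (G 0)) a ℓ
      = - (otherBlock (G 0) ℓ *ᵥ u) ⟨i, hi⟩ := by
    rw [Matrix.mulVec, dotProduct, ← Finset.sum_neg_distrib]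
    refine Finset.sum_congr rfl fun a _ => ?_
    rw [Matrix.sub_apply, corrected, Matrix.of_apply, dif_neg a.2, add_zero, hu, otherBlock,
      Matrix.of_apply]
    ring
  rw [e1, e2, h1, add_neg_cancel]

/-! ### Measurability of the decentralized scheme -/

theorem measurable_correction (hV : IsZFScheme V) (ℓ : Fin K) (a : {a : Ant N // a.1 = 0}) :
    Measurable fun I : HierInfo K N 0 => correction V I ℓ a := by
  have hI : ∀ (k : {k : Fin M // (0 : Fin M) ≤ k}) (i : Fin K) (b : Ant N),
      Measurable fun I : HierInfo K N 0 => I k i b := fun k i b =>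
    (measurable_entry i b).comp (measurable_pi_apply k)
  have hVI : ∀ (k : {k : Fin M // (0 : Fin M) ≤ k}) (b : Ant N) (i : Fin K),
      Measurable fun I : HierInfo K N 0 => V (I k) b i := fun k b i =>
    (measurable_matrix_apply b i).comp (hV.measurable.comp (measurable_pi_apply k))
  have hpinv : ∀ a i, Measurable fun I : HierInfo K N 0 =>
      pinv (ownBlock (I ⟨0, le_rfl⟩) ℓ) a i := fun a i =>
    (isArithClosed_measurableFun _).pinv_mem (A := fun I : HierInfo K N 0 =>
      ownBlock (I ⟨0, le_rfl⟩) ℓ) (fun i a => hI _ _ _) a i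
  simp only [correction_apply]
  refine Finset.measurable_fun_sum _ fun i _ => (hpinv a i).mul
    (Finset.measurable_fun_sum _ fun b _ => (hI _ _ _).mul ((hVI _ _ _).sub (hVI _ _ _)))

theorem measurable_nominal (hV : IsZFScheme V) (μ : ℝ) (j : Fin M) :
    Measurable (nominal V μ j) := by
  refine measurable_matrix fun n ℓ => ?_
  refine Measurable.const_mul (Measurable.add ?_ ?_) _
  · exact (measurable_matrix_apply (⟨j, n⟩ : Ant N) ℓ).comp
      (hV.measurable.comp (measurable_pi_apply (⟨j, le_rfl⟩ : {k : Fin M // j ≤ k})))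
  · by_cases h : j = 0
    · subst h
      simp only [dif_pos]
      exact measurable_correction hV _ _
    · simp only [dif_neg h]
      exact measurable_const

theorem measurable_rowNorm {ι : Type*} (a : ι) :
    Measurable fun T : Matrix ι (Fin K) ℂ => rowNorm T a :=
  (Finset.measurable_fun_sum _ fun i _ =>
    ((measurable_matrix_apply a i).norm.pow_const 2)).sqrt

theorem measurable_cdzf (hV : IsZFScheme V) (μ : ℝ) {F : HierStrategy K N}
    (hF : ∀ j, Measurable (F j)) (j : Fin M) : Measurable (cdzf V μ F j) := by
  classical
  refine Measurable.ite ?_ (hF j) (measurable_nominal hV μ j)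
  have : {I | InOutage V μ j I} = ⋃ n, {I | 1 < rowNorm (nominal V μ j I) n} := by
    ext I; simp [InOutage]
  rw [this]
  exact MeasurableSet.iUnion fun n => measurableSet_lt measurable_const
    ((measurable_rowNorm n).comp (measurable_nominal hV μ j))

theorem measurable_precoder (hV : IsZFScheme V) (μ : ℝ) {F : HierStrategy K N}
    (hF : ∀ j, Measurable (F j)) : Measurable fun G => (cdzf V μ F).precoder G :=
  measurable_matrix fun a ℓ => (measurable_matrix_apply a.2 ℓ).comp
    ((measurable_cdzf hV μ hF a.1).comp (measurable_pi_iff.2 fun _ => measurable_pi_apply _))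

/-! ### The probability of power outage -/

variable {Ω : Type*} [MeasurableSpace Ω] {Pr : Measure Ω} [IsProbabilityMeasure Pr]
  {H : Ω → Channel K N} {Δ : Fin M → Ω → Channel K N} {α : Fin M → ℝ}

/-- The estimates of all TXs at SNR `P`. -/
noncomputable def estimates (α : Fin M → ℝ) (H : Ω → Channel K N) (Δ : Fin M → Ω → Channel K N)
    (P : ℝ) (ω : Ω) : Fin M → Channel K N :=
  fun j => estimate P (α j) (H ω) (Δ j ω)

/-- All entries of the precoder after the correction are close to those of the centralized one: the
correction is a product of quantities that grow more slowly than every power of the SNR and of the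
small deviation of the other TXs. -/
theorem isClose_corrected (hV : IsZFScheme V) (h : IsCSITModel Pr H Δ) {b : ℝ} (hb : 0 < b)
    (hα : ∀ j, b ≤ α j / 2) (a : Ant N) (ℓ : Fin K) :
    IsClose Pr b (fun p => corrected V (estimates α H Δ p.1 p.2) a ℓ)
      (fun p => V (estimates α H Δ p.1 p.2 0) a ℓ) := by
  have hα0 : ∀ j, 0 ≤ α j := fun j => by linarith [hα j]
  have hVV : ∀ (j : Fin M) (c : Ant N), IsClose Pr b
      (fun p => V (estimates α H Δ p.1 p.2 j) c ℓ)
      (fun p => V (estimates α H Δ p.1 p.2 0) c ℓ) := fun j c =>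
    hV.isClose h hb (hα j) (hα 0) c ℓ
  have hcorr : IsClose Pr b (fun p => if h : a.1 = 0 then
      correction V (hierInfo (estimates α H Δ p.1 p.2) 0) ℓ ⟨a, h⟩ else 0) 0 := by
    by_cases ha : a.1 = 0
    · simp only [dif_pos ha, correction_hierInfo]
      have hsub : ∀ f ∈ algebraicFun (coord (K := K) (N := N)),
          IsSubpoly Pr fun p => f (estimates α H Δ p.1 p.2 0) := fun f hf =>
        isSubpoly_of_mem_algebraicFun (Z := fun P ω => estimates α H Δ P ω 0)
          (h.hasLaw_coord_estimate 0 (hα0 0)) hf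
      have hpinv : ∀ i, (fun G : Channel K N => pinv (ownBlock G ℓ) ⟨a, ha⟩ i)
          ∈ algebraicFun (coord (K := K) (N := N)) := fun i =>
        (isArithClosed_algebraicFun coord).pinv_mem (A := fun G : Channel K N => ownBlock G ℓ)
          (fun i a => entry_mem_algebraicFun i.1 a.1) ⟨a, ha⟩ i
      have hentry : ∀ (i : Fin K) (c : Ant N),
          IsSubpoly Pr fun p => estimates α H Δ p.1 p.2 0 i c := fun i c =>
        hsub (fun G => G i c) (entry_mem_algebraicFun i c)
      refine IsClose.sum_zero Finset.univ fun i _ => IsClose.mul_zero_of_subpoly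
        (hsub _ (hpinv i)) (IsClose.sum_zero Finset.univ fun c _ => ?_)
      exact IsClose.mul_zero_of_subpoly (hentry i.1 c.1)
        (IsClose.sub_zero_iff.2 (hVV c.1.1 c.1).symm)
    · simp only [dif_neg ha]
      exact IsClose.refl (x := (0 : ℝ × Ω → ℂ))
  simpa [corrected] using (hVV a.1 a).add hcorr

/-- The correction of TX `0` is smaller, by a power of the SNR, than the back-off. -/
theorem eventually_not_inOutage (hV : IsZFScheme V) (h : IsCSITModel Pr H Δ) {αμ : ℝ}
    (hαμ : 0 ≤ αμ) (hα : ∀ j, αμ < α j) {μ : ℝ → ℝ} (hμ : ∀ P, 0 < μ P ∧ μ P < 1)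
    (hμ_rate : (fun P => √P ^ (-αμ)) =O[atTop] fun P => 1 - μ P) :
    ∀ᶠ p in whp Pr, ∀ j, ¬ InOutage V (μ p.1) j (hierInfo (estimates α H Δ p.1 p.2) j) := by
  obtain ⟨β, hβ1, hβ2⟩ : ∃ β, αμ < β ∧ ∀ j, β < α j := by
    obtain ⟨j, hj⟩ := Finite.exists_min α
    obtain ⟨β, h1, h2⟩ := exists_between (hα j)
    exact ⟨β, h1, fun k => h2.trans_le (hj k)⟩
  obtain ⟨γ, hγ1, hγ2⟩ := exists_between hβ1
  obtain ⟨C, hC, hbound⟩ := hμ_rate.exists_pos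
  have hclose : ∀ a ℓ, ∀ᶠ p in whp Pr, ‖corrected V (estimates α H Δ p.1 p.2) a ℓ
      - V (estimates α H Δ p.1 p.2 0) a ℓ‖ ≤ p.1 ^ (-(γ / 2)) := fun a ℓ =>
    isClose_corrected hV h (b := β / 2) (by linarith) (fun j => by linarith [hβ2 j]) a ℓ (γ / 2)
      (by linarith)
  filter_upwards [eventually_all.2 fun a => eventually_all.2 (hclose a),
    tendsto_fst_whp.eventually hbound.bound, tendsto_fst_whp.eventually (eventually_gt_atTop 0),
    tendsto_fst_whp.eventually (eventually_const_mul_rpow_le (K * C)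
      (show -(γ / 2) < -(αμ / 2) by linarith))] with p h1 h2 h3 h4
  intro j
  by_cases hj : j = 0
  · subst hj
    rintro ⟨n, hn⟩
    refine absurd hn (not_lt.2 (rowNorm_nominal_le hV (hμ _).1.le _ _ n ?_))
    refine (Finset.sum_le_sum fun ℓ _ => h1 ⟨0, n⟩ ℓ).trans ?_
    rw [Finset.sum_const, Finset.card_univ, Fintype.card_fin, nsmul_eq_mul]
    change ‖noiseWeight p.1 αμ‖ ≤ _ at h2
    rw [Real.norm_of_nonneg (noiseWeight_nonneg _ _), noiseWeight_eq_rpow h3.le,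
      Real.norm_of_nonneg (by linarith [(hμ p.1).2])] at h2
    refine le_of_mul_le_mul_left (le_trans (le_of_eq ?_) (h4.trans h2)) hC
    ring
  · exact not_inOutage_of_ne_zero hV (hμ _).1.le (hμ _).2.le _ hj

theorem rpow_neg_isLittleO_inv_logb {ε : ℝ} (hε : 0 < ε) :
    (fun P : ℝ => P ^ (-ε)) =o[atTop] fun P => 1 / Real.logb 2 P := by
  have h1 : (fun P : ℝ => Real.logb 2 P) =o[atTop] fun P : ℝ => P ^ ε := by
    have : (fun P : ℝ => Real.logb 2 P) = fun P => (Real.log 2)⁻¹ * Real.log P := by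
      funext P; rw [Real.logb, div_eq_inv_mul]
    rw [this]
    exact (isLittleO_log_rpow_atTop hε).const_mul_left _
  have h2 := h1.inv_rev (by
    filter_upwards [eventually_gt_atTop 1] with P hP h0
    exact absurd h0 (Real.logb_pos one_lt_two hP).ne')
  refine (h2.congr' ?_ ?_)
  · filter_upwards [eventually_ge_atTop 0] with P hP
    rw [Real.rpow_neg hP]
  · exact Eventually.of_forall fun P => (one_div _).symm

end Decentralized

/-! ### Comparison of instantaneous rates -/

theorem log_one_add_mul_sq_le {P x y η : ℝ} (hP : 0 ≤ P) (hx : 0 ≤ x) (hη : 0 ≤ η)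
    (h : x ≤ (1 + η) * y) : Real.log (1 + P * x ^ 2) ≤ Real.log (1 + P * y ^ 2) + 2 * η := by
  have h1 : 1 + P * x ^ 2 ≤ (1 + η) ^ 2 * (1 + P * y ^ 2) := by
    have h2 : x ^ 2 ≤ ((1 + η) * y) ^ 2 := pow_le_pow_left₀ hx h 2
    nlinarith [mul_le_mul_of_nonneg_left h2 hP, sq_nonneg η]
  calc Real.log (1 + P * x ^ 2) ≤ Real.log ((1 + η) ^ 2 * (1 + P * y ^ 2)) :=
        Real.log_le_log (by positivity) h1
    _ = 2 * Real.log (1 + η) + Real.log (1 + P * y ^ 2) := by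
        rw [Real.log_mul (by positivity) (by positivity), Real.log_pow]
        push_cast; rfl
    _ ≤ _ := by linarith [Real.log_le_sub_one_of_pos (show 0 < 1 + η by linarith)]

theorem abs_log_one_add_mul_sq_sub_le {P x y η : ℝ} (hP : 0 ≤ P) (hx : 0 ≤ x) (hy : 0 ≤ y)
    (hη : 0 ≤ η) (hη' : η ≤ 1 / 2) (h : |x - y| ≤ η * y) :
    |Real.log (1 + P * x ^ 2) - Real.log (1 + P * y ^ 2)| ≤ 4 * η := by
  obtain ⟨h1, h2⟩ := abs_le.1 h
  have h3 : y ≤ (1 + 2 * η) * x := by nlinarith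
  have h4 := log_one_add_mul_sq_le hP hx hη (by linarith : x ≤ (1 + η) * y)
  have h5 := log_one_add_mul_sq_le hP hy (by linarith) h3
  rw [abs_le]
  constructor <;> linarith

theorem abs_log_l2Norm_sub_le {K : ℕ} {s : Finset (Fin K)} {x y : Fin K → ℂ} {P δ : ℝ}
    (hP : 0 ≤ P) (hδ : 0 ≤ δ) (hδ' : K * δ ≤ 1 / 2)
    (h : ∀ ℓ ∈ s, ‖x ℓ - y ℓ‖ ≤ δ * l2Norm s y) :
    |Real.log (1 + P * l2Norm s x ^ 2) - Real.log (1 + P * l2Norm s y ^ 2)| ≤ 4 * (K * δ) := by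
  refine abs_log_one_add_mul_sq_sub_le hP (l2Norm_nonneg _ _) (l2Norm_nonneg _ _) (by positivity)
    hδ' ((abs_l2Norm_sub_le s x y).trans ((Finset.sum_le_sum h).trans ?_))
  rw [Finset.sum_const, nsmul_eq_mul, mul_assoc]
  have hy := l2Norm_nonneg s y
  gcongr
  exact_mod_cast (Finset.card_le_univ s).trans (by simp)

section Rate

variable {K M : ℕ} {N : Fin M → ℕ}

/-- The rate compares the total received power with the received interference. -/
theorem instRate_eq {P : ℝ} (hP : 0 ≤ P) (H : Channel K N) (T : Precoder N K) (i : Fin K) :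
    instRate P H T i = (Real.log (1 + P * l2Norm Finset.univ ((H * T) i) ^ 2)
      - Real.log (1 + P * l2Norm (Finset.univ.erase i) ((H * T) i) ^ 2)) / Real.log 2 := by
  have h1 : (0 : ℝ) < 1 + P * l2Norm (Finset.univ.erase i) ((H * T) i) ^ 2 := by positivity
  rw [instRate, Real.logb, ← Real.log_div (by positivity) h1.ne', l2Norm_sq, l2Norm_sq]
  rw [l2Norm_sq] at h1
  rw [← Finset.mul_sum, ← Finset.add_sum_erase Finset.univ _ (Finset.mem_univ i)]
  congr 2
  field_simp
  ring

/-- Scaling by `m` and replacing the precoder `X` by `W` hardly changes the rate of RX `i` if both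
zero-force the estimate `G`. As `G` drops out of the interference, the latter is only compared
with respect to the remainder `D` of the channel. -/
theorem abs_instRate_smul_sub_le {P c z m ρ : ℝ} (hP : 0 < P) (hz : 0 ≤ z) (hm : 0 ≤ m)
    (hm1 : m ≤ 1) (hρ : 0 ≤ ρ) (hsmall : K * ((1 - m) + ρ) ≤ 1 / 2) {H G D : Channel K N}
    (hH : H = (c : ℂ) • G - (z : ℂ) • D) {X W : Precoder N K} {i : Fin K}
    (hX : ∀ ℓ, ℓ ≠ i → (G * X) i ℓ = 0) (hW : ∀ ℓ, ℓ ≠ i → (G * (W - X)) i ℓ = 0)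
    (htot : ∀ ℓ, ‖(H * (W - X)) i ℓ‖ ≤ ρ * ‖(H * X) i i‖)
    (hint : ∀ ℓ, ‖(D * (W - X)) i ℓ‖ ≤ ρ * ‖(D * X) i ℓ‖) :
    |instRate P H X i - instRate P H ((m : ℂ) • W) i|
      ≤ 8 / Real.log 2 * (K * ((1 - m) + ρ)) := by
  have hsplit : ∀ Y : Precoder N K, ∀ ℓ, (G * Y) i ℓ = 0 →
      ‖(H * Y) i ℓ‖ = z * ‖(D * Y) i ℓ‖ := by
    intro Y ℓ hY
    rw [hH, Matrix.sub_mul, Matrix.smul_mul, Matrix.smul_mul, Matrix.sub_apply,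
      Matrix.smul_apply, hY, smul_zero, zero_sub, norm_neg, Matrix.smul_apply, smul_eq_mul,
      norm_mul, Complex.norm_real, Real.norm_of_nonneg hz]
  have hm' : 0 ≤ 1 - m := sub_nonneg.2 hm1
  -- the deviation consists of the loss by the power back-off and of the change of the precoder
  have hdev : ∀ ℓ, ‖(H * ((m : ℂ) • W)) i ℓ - (H * X) i ℓ‖
      ≤ (1 - m) * ‖(H * X) i ℓ‖ + ‖(H * (W - X)) i ℓ‖ := by
    intro ℓ
    have e : (H * ((m : ℂ) • W)) i ℓ - (H * X) i ℓ
        = (m : ℂ) * (H * (W - X)) i ℓ - ((1 - m : ℝ) : ℂ) * (H * X) i ℓ := by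
      rw [Matrix.mul_smul, Matrix.smul_apply, smul_eq_mul, Matrix.mul_sub, Matrix.sub_apply]
      push_cast
      ring
    rw [e]
    refine (norm_sub_le _ _).trans ?_
    rw [norm_mul, norm_mul, Complex.norm_real, Complex.norm_real, Real.norm_of_nonneg hm,
      Real.norm_of_nonneg hm', add_comm]
    gcongr
    exact mul_le_of_le_one_left (norm_nonneg _) hm1
  have hδ : 0 ≤ (1 - m) + ρ := add_nonneg hm' hρ
  have htotal : |Real.log (1 + P * l2Norm Finset.univ ((H * ((m : ℂ) • W)) i) ^ 2)
      - Real.log (1 + P * l2Norm Finset.univ ((H * X) i) ^ 2)| ≤ 4 * (K * ((1 - m) + ρ)) := by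
    refine abs_log_l2Norm_sub_le hP.le hδ hsmall fun ℓ _ => (hdev ℓ).trans ?_
    rw [add_mul]
    exact add_le_add (mul_le_mul_of_nonneg_left (norm_le_l2Norm _ (Finset.mem_univ ℓ)) hm')
      ((htot ℓ).trans (mul_le_mul_of_nonneg_left (norm_le_l2Norm _ (Finset.mem_univ i)) hρ))
  have hinterf : |Real.log (1 + P * l2Norm (Finset.univ.erase i) ((H * ((m : ℂ) • W)) i) ^ 2)
      - Real.log (1 + P * l2Norm (Finset.univ.erase i) ((H * X) i) ^ 2)|
      ≤ 4 * (K * ((1 - m) + ρ)) := by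
    refine abs_log_l2Norm_sub_le hP.le hδ hsmall fun ℓ hℓ => (hdev ℓ).trans ?_
    have hℓi : ℓ ≠ i := (Finset.mem_erase.1 hℓ).1
    refine le_trans (le_of_le_of_eq (add_le_add le_rfl ?_) (add_mul _ _ _).symm)
      (mul_le_mul_of_nonneg_left (norm_le_l2Norm _ hℓ) hδ)
    rw [hsplit _ ℓ (hW ℓ hℓi), hsplit _ ℓ (hX ℓ hℓi), mul_left_comm]
    exact mul_le_mul_of_nonneg_left (hint ℓ) hz
  rw [instRate_eq hP.le, instRate_eq hP.le, ← sub_div, abs_div,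
    abs_of_pos (Real.log_pos one_lt_two), div_mul_eq_mul_div]
  refine div_le_div_of_nonneg_right ?_ (Real.log_pos one_lt_two).le
  rw [abs_le] at htotal hinterf ⊢
  constructor <;> linarith [htotal.1, htotal.2, hinterf.1, hinterf.2]

theorem instRate_nonneg {P : ℝ} (hP : 0 ≤ P) (H : Channel K N) (T : Precoder N K) (i : Fin K) :
    0 ≤ instRate P H T i := by
  refine Real.logb_nonneg one_lt_two (le_add_of_nonneg_right ?_)
  have : 0 ≤ ∑ ℓ ∈ Finset.univ.erase i, P * ‖(H * T) i ℓ‖ ^ 2 :=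
    Finset.sum_nonneg fun _ _ => by positivity
  positivity

theorem instRate_le {P : ℝ} (hP : 0 ≤ P) (H : Channel K N) {T : Precoder N K}
    (hT : ∀ a, rowNorm T a ≤ 1) (i : Fin K) :
    instRate P H T i ≤ Real.logb 2 (1 + P) + 2 / Real.log 2 * ∑ a, ‖H i a‖ := by
  have hs : ‖(H * T) i i‖ ≤ ∑ a, ‖H i a‖ := by
    rw [Matrix.mul_apply]
    refine (norm_sum_le _ _).trans (Finset.sum_le_sum fun a _ => ?_)
    rw [norm_mul]
    exact mul_le_of_le_one_right (norm_nonneg _) ((norm_entry_le_rowNorm T a i).trans (hT a))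
  set S := ∑ a, ‖H i a‖ with hS
  have hS0 : 0 ≤ S := Finset.sum_nonneg fun _ _ => norm_nonneg _
  have hI : 0 ≤ ∑ ℓ ∈ Finset.univ.erase i, P * ‖(H * T) i ℓ‖ ^ 2 :=
    Finset.sum_nonneg fun _ _ => by positivity
  have hlog : 0 < Real.log 2 := Real.log_pos one_lt_two
  have h1 : 1 + P * ‖(H * T) i i‖ ^ 2 / (1 + ∑ ℓ ∈ Finset.univ.erase i, P * ‖(H * T) i ℓ‖ ^ 2)
      ≤ (1 + P) * (1 + S) ^ 2 := by
    have h2 : P * ‖(H * T) i i‖ ^ 2 / (1 + ∑ ℓ ∈ Finset.univ.erase i, P * ‖(H * T) i ℓ‖ ^ 2)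
        ≤ P * ‖(H * T) i i‖ ^ 2 := div_le_self (by positivity) (by linarith)
    have h3 : P * ‖(H * T) i i‖ ^ 2 ≤ P * S ^ 2 := by gcongr
    nlinarith [mul_nonneg hP hS0]
  have h2 : instRate P H T i ≤ Real.logb 2 ((1 + P) * (1 + S) ^ 2) :=
    Real.logb_le_logb_of_le one_lt_two (by positivity) h1
  refine h2.trans ?_
  rw [Real.logb_mul (by positivity) (by positivity)]
  have h4 : Real.logb 2 ((1 + S) ^ 2) ≤ 2 / Real.log 2 * S := by
    rw [Real.logb, Real.log_pow, div_mul_eq_mul_div]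
    push_cast
    gcongr
    linarith [Real.log_le_sub_one_of_pos (show 0 < 1 + S by linarith)]
  linarith

theorem measurable_instRate (P : ℝ) (i : Fin K) :
    Measurable fun q : Channel K N × Precoder N K => instRate P q.1 q.2 i := by
  have hm : ∀ ℓ, Measurable fun q : Channel K N × Precoder N K => (q.1 * q.2) i ℓ := fun ℓ =>
    IsArithClosed.matrix_mul_mem (S := measurableFun (Channel K N × Precoder N K))
      (fun i a => (measurable_entry i a).comp measurable_fst)
      (fun a l => (measurable_matrix_apply a l).comp measurable_snd) i ℓ
  have hp : ∀ ℓ, Measurable fun q : Channel K N × Precoder N K => P * ‖(q.1 * q.2) i ℓ‖ ^ 2 :=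
    fun ℓ => ((hm ℓ).norm.pow_const 2).const_mul P
  have h := ((hp i).div ((Finset.measurable_fun_sum (Finset.univ.erase i)
    fun ℓ _ => hp ℓ).const_add 1)).const_add 1
  exact (Real.measurable_log.comp h).div_const _

variable {Ω : Type*} [MeasurableSpace Ω] {Pr : Measure Ω} [IsProbabilityMeasure Pr]
  {H : Ω → Channel K N} {Δ : Fin M → Ω → Channel K N} {α : Fin M → ℝ}

omit [IsProbabilityMeasure Pr] in
theorem integrable_norm_entry {X : Ω → Channel K N} (hX : HasLaw X (channelLaw K N) Pr)
    (i : Fin K) (a : Ant N) : Integrable (fun ω => ‖X ω i a‖) Pr := by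
  have hcoord : ∀ s : Coord K N, Integrable (fun ω => coord (X ω) s) Pr := by
    intro s
    have hlaw : HasLaw (fun ω => coord (X ω) s) (gaussianReal 0 (1 / 2)) Pr :=
      (measurePreserving_eval (fun _ : Coord K N => gaussianReal 0 (1 / 2)) s).fun_comp_hasLaw
        (measurePreserving_coord.fun_comp_hasLaw hX)
    have hint : Integrable (fun y : ℝ => y) (gaussianReal 0 (1 / 2)) := IsGaussian.integrable_id
    rw [← hlaw.map_eq] at hint
    exact hint.comp_aemeasurable hlaw.aemeasurable
  refine ((hcoord ((i, a), true)).norm.add (hcoord ((i, a), false)).norm).mono'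
    ((measurable_entry i a).norm.comp_aemeasurable hX.aemeasurable).aestronglyMeasurable
    (ae_of_all _ fun ω => ?_)
  simpa [coord] using Complex.norm_le_abs_re_add_abs_im (X ω i a)

theorem integrable_instRate {P : ℝ} (hP : 0 ≤ P) (hH : HasLaw H (channelLaw K N) Pr)
    {T : Ω → Precoder N K} (hT : AEMeasurable T Pr) (hpow : ∀ ω a, rowNorm (T ω) a ≤ 1)
    (i : Fin K) : Integrable (fun ω => instRate P (H ω) (T ω) i) Pr := by
  refine Integrable.mono' (g := fun ω => Real.logb 2 (1 + P) + 2 / Real.log 2 * ∑ a, ‖H ω i a‖)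
    ((integrable_const _).add ((integrable_finsetSum _ fun a _ =>
      integrable_norm_entry hH i a).const_mul _))
    ((measurable_instRate P i).comp_aemeasurable (hH.aemeasurable.prodMk hT)).aestronglyMeasurable
    (ae_of_all _ fun ω => ?_)
  rw [Real.norm_of_nonneg (instRate_nonneg hP _ _ _)]
  exact instRate_le hP _ (hpow ω) i

/-- A difference that is small off an event of polynomially small probability, and at most
logarithmic in the SNR up to an integrable term, vanishes in the mean. -/
theorem tendsto_integral_zero_of_whp {f : ℝ → Ω → ℝ} {Y : Ω → ℝ} {η : ℝ → ℝ}
    (hf : ∀ P, 1 ≤ P → Integrable (f P) Pr) (hY : Integrable Y Pr)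
    (hfY : ∀ P, 1 ≤ P → ∀ ω, |f P ω| ≤ Real.logb 2 (1 + P) + Y ω)
    (hη : Tendsto η atTop (nhds 0)) (h : ∀ᶠ p in whp Pr, |f p.1 p.2| ≤ η p.1) :
    Tendsto (fun P => ∫ ω, f P ω ∂Pr) atTop (nhds 0) := by
  obtain ⟨ε, hε, hO⟩ := eventually_whp.1 h
  set B : ℝ → Set Ω := fun P => {ω | ¬ |f P ω| ≤ η P} with hB
  have hO' : (fun P => Pr.real (B P)) =O[atTop] fun P : ℝ => P ^ (-ε) := hO
  have hpow : Tendsto (fun P : ℝ => P ^ (-ε)) atTop (nhds 0) := tendsto_rpow_neg_atTop hε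
  have hBreal : Tendsto (fun P => Pr.real (B P)) atTop (nhds 0) := hO'.trans_tendsto hpow
  have hBmeas : Tendsto (Pr ∘ B) atTop (nhds 0) := by
    have := ENNReal.tendsto_ofReal hBreal
    simpa [Function.comp_def, measureReal_def, ENNReal.ofReal_toReal] using this
  have hint : Tendsto (fun P => ∫ ω in B P, Y ω ∂Pr) atTop (nhds 0) :=
    hY.tendsto_setIntegral_nhds_zero hBmeas
  have hlog : Tendsto (fun P => Real.logb 2 (1 + P) * Pr.real (B P)) atTop (nhds 0) := by
    have h1 : (fun P : ℝ => Real.logb 2 (1 + P)) =O[atTop] fun P => Real.log P := by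
      refine IsBigO.of_bound (2 / Real.log 2) ?_
      filter_upwards [eventually_ge_atTop 2] with P hP
      have hl2 : 0 < Real.log 2 := Real.log_pos one_lt_two
      rw [Real.norm_of_nonneg (Real.logb_nonneg one_lt_two (by linarith)),
        Real.norm_of_nonneg (Real.log_nonneg (by linarith)), Real.logb, div_mul_eq_mul_div]
      gcongr
      have h2 : Real.log (1 + P) ≤ Real.log (P ^ 2) :=
        Real.log_le_log (by linarith) (by nlinarith)
      rwa [Real.log_pow, Nat.cast_ofNat] at h2
    have h3 := h1.trans_isLittleO (isLittleO_log_rpow_atTop hε) |>.mul_isBigO hO'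
    have h4 : (fun P : ℝ => P ^ ε * P ^ (-ε)) =ᶠ[atTop] fun _ => (1 : ℝ) := by
      filter_upwards [eventually_gt_atTop 0] with P hP
      rw [← Real.rpow_add hP, add_neg_cancel, Real.rpow_zero]
    exact (isLittleO_one_iff ℝ).1 (h3.trans_eventuallyEq h4)
  have hsum := (hη.abs.add hlog).add hint
  rw [abs_zero, add_zero, add_zero] at hsum
  refine squeeze_zero_norm' ?_ hsum
  filter_upwards [eventually_ge_atTop 1] with P hP
  have hBnull : NullMeasurableSet (B P) Pr :=
    (nullMeasurableSet_le (hf P hP).aestronglyMeasurable.aemeasurable.abs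
      aemeasurable_const).compl
  have hle : ∫ ω in B P, |f P ω| ∂Pr
      ≤ Real.logb 2 (1 + P) * Pr.real (B P) + ∫ ω in B P, Y ω ∂Pr := by
    calc ∫ ω in B P, |f P ω| ∂Pr ≤ ∫ ω in B P, (Real.logb 2 (1 + P) + Y ω) ∂Pr :=
          integral_mono (hf P hP).abs.integrableOn
            ((integrable_const _).add hY.integrableOn) (hfY P hP)
      _ = _ := by
          rw [integral_add (integrable_const _) hY.integrableOn, setIntegral_const, smul_eq_mul,
            mul_comm]
  have hle' : ∫ ω in (B P)ᶜ, |f P ω| ∂Pr ≤ |η P| := by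
    calc ∫ ω in (B P)ᶜ, |f P ω| ∂Pr ≤ ∫ _ in (B P)ᶜ, |η P| ∂Pr := by
          refine setIntegral_mono_on₀ (hf P hP).abs.integrableOn
            (integrable_const _).integrableOn hBnull.compl fun ω hω => ?_
          simp only [hB, Set.mem_compl_iff, Set.mem_ofPred_eq, not_not] at hω
          exact hω.trans (le_abs_self _)
      _ ≤ |η P| := by
          rw [setIntegral_const, smul_eq_mul]
          exact mul_le_of_le_one_left (abs_nonneg _) measureReal_le_one
  calc ‖∫ ω, f P ω ∂Pr‖ ≤ ∫ ω, |f P ω| ∂Pr := norm_integral_le_integral_norm _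
    _ = ∫ ω in B P, |f P ω| ∂Pr + ∫ ω in (B P)ᶜ, |f P ω| ∂Pr :=
        (integral_add_compl₀ hBnull (hf P hP).abs).symm
    _ ≤ _ := by linarith

theorem isClose_matrix_mul_zero {l m n : Type*} [Fintype m] {A : ℝ × Ω → Matrix l m ℂ}
    {B : ℝ × Ω → Matrix m n ℂ} {b : ℝ} {i : l} {j : n}
    (hA : ∀ k, IsSubpoly Pr fun p => A p i k) (hB : ∀ k, IsClose Pr b (fun p => B p k j) 0) :
    IsClose Pr b (fun p => (A p * B p) i j) 0 :=
  IsClose.sum_zero Finset.univ fun k _ => (hB k).mul_zero_of_subpoly (hA k)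

theorem IsCSITModel.isSubpoly_complement (h : IsCSITModel Pr H Δ) (j : Fin M) {α : ℝ}
    (hα : 0 ≤ α) (i : Fin K) (a : Ant N) :
    IsSubpoly Pr fun p => complement p.1 α (H p.2) (Δ j p.2) i a := by
  have hmem : (fun q : Channel K N × Channel K N => q.2 i a)
      ∈ algebraicFun (pairCoord (K := K) (N := N)) :=
    entry_mem_of_coord_mem (fun s => coord_mem_algebraicFun (c := pairCoord) (Sum.inr s)) i a
  exact isSubpoly_of_mem_algebraicFun (c := pairCoord) (f := fun q => q.2 i a)
    (Z := fun P ω => (estimate P α (H ω) (Δ j ω), complement P α (H ω) (Δ j ω)))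
    (h.hasLaw_pairCoord j hα) hmem

theorem IsZFScheme.isClose_mul_sub {V : Channel K N → Precoder N K} (hV : IsZFScheme V)
    (h : IsCSITModel Pr H Δ) (j : Fin M) {α b : ℝ} (hb : b ≤ α / 2) (hb0 : 0 ≤ b) (i : Fin K) :
    IsClose Pr b (fun p => ((H p.2 - estimate p.1 α (H p.2) (Δ j p.2))
      * V (estimate p.1 α (H p.2) (Δ j p.2))) i i) 0 := by
  refine IsClose.sum_zero Finset.univ fun a _ => ?_
  have h1 : IsSubpoly Pr fun p => V (estimate p.1 α (H p.2) (Δ j p.2)) a i :=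
    (IsSubpoly.const 1).mono (Eventually.of_forall fun p => by
      rw [norm_one]
      exact (norm_entry_le_rowNorm _ _ _).trans (hV.power _ _))
  have h2 : IsClose Pr b (fun p => (H p.2 - estimate p.1 α (H p.2) (Δ j p.2)) i a) 0 :=
    IsClose.sub_zero_iff.2 ((h.isClose_estimate_channel j (by linarith) i a).of_le hb).symm
  simpa only [mul_comm] using h2.mul_zero_of_subpoly h1

variable [NeZero M] {V : Channel K N → Precoder N K}

theorem eventually_zero_forcing_and_mul_pinv (hN : K ≤ N 0 + 1) (hV : IsZFScheme V)
    (h : IsCSITModel Pr H Δ) {α : Fin M → ℝ} (hα : 0 ≤ α 0) :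
    ∀ᶠ p in whp Pr,
      (∀ i ℓ, ℓ ≠ i → (estimates α H Δ p.1 p.2 0 * V (estimates α H Δ p.1 p.2 0)) i ℓ = 0) ∧
      ∀ ℓ, ownBlock (estimates α H Δ p.1 p.2 0) ℓ * pinv (ownBlock (estimates α H Δ p.1 p.2 0) ℓ)
        = 1 := by
  refine eventually_whp_of_ae ?_
  filter_upwards [eventually_ge_atTop 1] with P hP
  have hl := h.hasLaw_estimate 0 hP hα
  have hall := hV.zero_forcing.and (ae_ownBlock_mul_pinv (N := N) hN)
  rw [← hl.map_eq] at hall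
  exact ae_of_ae_map hl.aemeasurable hall

/-- With high probability, the rates of the centralized and of the decentralized scheme nearly
coincide. For the total received power this holds because the useful signal is not tiny. The
interference is proportional to the noise weight under both schemes, so only the products of the
precoders with the complement of the estimate have to be compared. -/
theorem eventually_abs_instRate_sub_le (hN : K ≤ N 0 + 1) (hV : IsZFScheme V)
    (hsignal : ∀ᵐ G ∂(channelLaw K N), ∀ i, (G * V G) i i ≠ 0) (h : IsCSITModel Pr H Δ) {αμ : ℝ}
    (hαμ : 0 < αμ) (hα : ∀ j, αμ < α j) {μ : ℝ → ℝ} (hμ : ∀ P, 0 < μ P ∧ μ P < 1)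
    (hμ_rate : (fun P => 1 - μ P) =Θ[atTop] fun P => √P ^ (-αμ)) (F : ℝ → HierStrategy K N)
    (i : Fin K) :
    ∃ η : ℝ → ℝ, Tendsto η atTop (nhds 0) ∧ ∀ᶠ p in whp Pr,
      |instRate p.1 (H p.2) (V (estimates α H Δ p.1 p.2 0)) i - instRate p.1 (H p.2)
        ((cdzf V (μ p.1) (F p.1)).precoder (estimates α H Δ p.1 p.2)) i| ≤ η p.1 := by
  have hα0 : ∀ j, 0 ≤ α j := fun j => by linarith [hα j]
  set b : ℝ := αμ / 2 with hb
  have hb0 : 0 < b := by positivity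
  have hbα : ∀ j, b ≤ α j / 2 := fun j => by linarith [hα j]
  set δ : ℝ → ℝ := fun P => (1 - μ P) + P ^ (-(b / 4)) with hδ
  have hδ0 : Tendsto δ atTop (nhds 0) := by
    have h1 : Tendsto (fun P => 1 - μ P) atTop (nhds 0) := by
      refine hμ_rate.isBigO.trans_tendsto ?_
      exact (tendsto_rpow_neg_atTop hαμ).comp Real.tendsto_sqrt_atTop
    simpa using h1.add (tendsto_rpow_neg_atTop (show 0 < b / 4 by positivity))
  have hKδ : Tendsto (fun P => K * δ P) atTop (nhds 0) := by simpa using hδ0.const_mul (K : ℝ)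
  refine ⟨fun P => 8 / Real.log 2 * (K * δ P), by simpa using hKδ.const_mul (8 / Real.log 2), ?_⟩
  have hW : ∀ a ℓ, IsClose Pr b (fun p => (corrected V (estimates α H Δ p.1 p.2)
      - V (estimates α H Δ p.1 p.2 0)) a ℓ) 0 := fun a ℓ =>
    IsClose.sub_zero_iff.2 (isClose_corrected hV h hb0 hbα a ℓ)
  have hHW : ∀ ℓ, IsClose Pr b (fun p => (H p.2 * (corrected V (estimates α H Δ p.1 p.2)
      - V (estimates α H Δ p.1 p.2 0))) i ℓ) 0 := fun ℓ =>
    isClose_matrix_mul_zero (isSubpoly_entry h.channel i) fun a => hW a ℓ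
  have hDW : ∀ ℓ, IsClose Pr b (fun p => (complement p.1 (α 0) (H p.2) (Δ 0 p.2)
      * (corrected V (estimates α H Δ p.1 p.2) - V (estimates α H Δ p.1 p.2 0))) i ℓ) 0 := fun ℓ =>
    isClose_matrix_mul_zero (h.isSubpoly_complement 0 (hα0 0) i) fun a => hW a ℓ
  have hHV := hV.isClose_mul_sub h 0 (hbα 0) hb0.le i
  have hae := eventually_zero_forcing_and_mul_pinv hN hV h (hα0 0)
  -- the useful signal is at least `P ^ (-b / 2)` and the deviation at most `P ^ (-3 b / 4)`; for the
  -- interference, divided by the noise weight, the bounds are `P ^ (-b / 4)` and `P ^ (-b / 2)`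
  filter_upwards [eventually_not_inOutage hV h hαμ.le hα hμ hμ_rate.isBigO_symm, hae,
    hV.eventually_le_norm_signal hsignal h 0 (hα0 0) (ε := b / 4) (by positivity) i,
    eventually_all.2 fun ℓ => hV.eventually_le_norm_complement hsignal h 0 (hα0 0)
      (ε := b / 4) (by positivity) i ℓ,
    eventually_all.2 fun ℓ => hHW ℓ (3 * b / 4) (by linarith),
    eventually_all.2 fun ℓ => hDW ℓ (b / 2) (by linarith),
    hHV (b / 2) (by linarith),
    tendsto_fst_whp.eventually
      (eventually_const_mul_rpow_le 2 (show -(b / 2) < -(b / 4) by linarith)),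
    tendsto_fst_whp.eventually (hKδ.eventually_le_const (show (0 : ℝ) < 1 / 2 by norm_num)),
    tendsto_fst_whp.eventually (eventually_ge_atTop 1)]
    with p hout hzf hsig hcomp hHW' hDW' hHV' hpow hsmall hp
  obtain ⟨hzf, hown⟩ := hzf
  rw [precoder_eq_smul_corrected hout]
  have hp0 : 0 < p.1 := by linarith
  have hdec := channel_eq_estimate_sub_complement hp (hα0 0) (H p.2) (Δ 0 p.2)
  have hzfW : ∀ ℓ, ℓ ≠ i → (estimates α H Δ p.1 p.2 0 * (corrected V (estimates α H Δ p.1 p.2)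
      - V (estimates α H Δ p.1 p.2 0))) i ℓ = 0 := fun ℓ hℓ =>
    mul_corrected_sub_eq_zero hℓ.symm (hown ℓ)
  change p.1 ^ (-(b / 4)) ≤ ‖(estimates α H Δ p.1 p.2 0 * V (estimates α H Δ p.1 p.2 0)) i i‖
    at hsig
  change ∀ ℓ, p.1 ^ (-(b / 4)) ≤ ‖(complement p.1 (α 0) (H p.2) (Δ 0 p.2)
    * V (estimates α H Δ p.1 p.2 0)) i ℓ‖ at hcomp
  change ‖((H p.2 - estimates α H Δ p.1 p.2 0) * V (estimates α H Δ p.1 p.2 0)) i i - 0‖ ≤ _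
    at hHV'
  change H p.2 = (channelWeight p.1 (α 0) : ℂ) • estimates α H Δ p.1 p.2 0 - _ at hdec
  simp only [Pi.zero_apply, sub_zero] at hHW' hDW' hHV'
  refine abs_instRate_smul_sub_le hp0 (noiseWeight_nonneg _ _) (hμ _).1.le (hμ _).2.le
    (Real.rpow_nonneg hp0.le _) hsmall hdec (hzf i) hzfW (fun ℓ => ?_) (fun ℓ => ?_)
  · have h1 : p.1 ^ (-(b / 2)) ≤ ‖(H p.2 * V (estimates α H Δ p.1 p.2 0)) i i‖ := by
      rw [Matrix.sub_mul, Matrix.sub_apply] at hHV'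
      have h2 := norm_le_norm_add_norm_sub ((H p.2 * V (estimates α H Δ p.1 p.2 0)) i i)
        ((estimates α H Δ p.1 p.2 0 * V (estimates α H Δ p.1 p.2 0)) i i)
      linarith
    calc _ ≤ p.1 ^ (-(3 * b / 4)) := hHW' ℓ
      _ = p.1 ^ (-(b / 4)) * p.1 ^ (-(b / 2)) := by rw [← Real.rpow_add hp0]; congr 1; ring
      _ ≤ _ := mul_le_mul_of_nonneg_left h1 (Real.rpow_nonneg hp0.le _)
  · calc _ ≤ p.1 ^ (-(b / 2)) := hDW' ℓ
      _ = p.1 ^ (-(b / 4)) * p.1 ^ (-(b / 4)) := by rw [← Real.rpow_add hp0]; congr 1; ring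
      _ ≤ _ := mul_le_mul_of_nonneg_left (hcomp ℓ) (Real.rpow_nonneg hp0.le _)

end Rate

end NetworkMISO

theorem mainTheorem2 {Ω : Type*} [MeasurableSpace Ω] (Pr : Measure Ω) [IsProbabilityMeasure Pr]
    {M K : ℕ} [NeZero M] (N : Fin M → ℕ) (hN : K ≤ N 0 + 1)
    (α : Fin M → ℝ) (hα_anti : StrictAnti α) (hα_le : α 0 ≤ 1) (hα_pos : ∀ j, 0 < α j)
    (H : Ω → NetworkMISO.Channel K N) (Δ : Fin M → Ω → NetworkMISO.Channel K N)
    (hmodel : NetworkMISO.IsCSITModel Pr H Δ)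
    (V : NetworkMISO.Channel K N → NetworkMISO.Precoder N K) (hV : NetworkMISO.IsZFScheme V)
    (hsignal : ∀ᵐ G ∂(NetworkMISO.channelLaw K N), ∀ i, (G * V G) i i ≠ 0)
    (αμ : ℝ) (hαμ_pos : 0 < αμ) (hαμ_lt : ∀ j, αμ < α j)
    (μ : ℝ → ℝ) (hμ : ∀ P, 0 < μ P ∧ μ P < 1)
    (hμ_rate : (fun P => 1 - μ P) =Θ[atTop] fun P => √P ^ (-αμ))
    (F : ℝ → NetworkMISO.HierStrategy K N) (hF_meas : ∀ P j, Measurable (F P j))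
    (hF_power : ∀ P j I n, NetworkMISO.rowNorm (F P j I) n ≤ 1)
    (G : ℝ → Ω → Fin M → NetworkMISO.Channel K N)
    (hG : ∀ P ω j, G P ω j = NetworkMISO.estimate P (α j) (H ω) (Δ j ω))
    (T : ℝ → Ω → NetworkMISO.Precoder N K)
    (hT : ∀ P ω, T P ω = (NetworkMISO.cdzf V (μ P) (F P)).precoder (G P ω)) :
    -- the per-antenna instantaneous power constraint always holds
    (∀ P ω a, NetworkMISO.rowNorm (T P ω) a ≤ 1) ∧
    -- all the instantaneous rates have finite expectation
    (∀ P, 1 ≤ P → ∀ i,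
      Integrable (fun ω => NetworkMISO.instRate P (H ω) (V (G P ω 0)) i) Pr ∧
      Integrable (fun ω => NetworkMISO.instRate P (H ω) (T P ω) i) Pr) ∧
    -- consistency holds with probability one
    (∀ P, 1 ≤ P → ∀ᵐ ω ∂Pr, ∀ j, j ≠ 0 →
      NetworkMISO.cdzf V (μ P) (F P) j (NetworkMISO.hierInfo (G P ω) j) =
        (μ P : ℂ) • NetworkMISO.predicted V (NetworkMISO.hierInfo (G P ω) 0) j) ∧
    -- the probability of power outage vanishes faster than `1 / log₂ P`
    ((fun P => Pr.real {ω | ∃ j,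
        NetworkMISO.InOutage V (μ P) j (NetworkMISO.hierInfo (G P ω) j)})
      =o[atTop] fun P => 1 / Real.logb 2 P) ∧
    -- the rate of the ideal centralized setting is asymptotically achieved
    Tendsto (fun P => NetworkMISO.sumRate Pr P H (fun ω => V (G P ω 0)) -
        NetworkMISO.sumRate Pr P H (T P)) atTop (nhds 0) := by
  obtain rfl : G = NetworkMISO.estimates α H Δ :=
    funext fun P => funext fun ω => funext fun j => hG P ω j
  obtain rfl : T = fun P ω =>
      (NetworkMISO.cdzf V (μ P) (F P)).precoder (NetworkMISO.estimates α H Δ P ω) :=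
    funext fun P => funext fun ω => hT P ω
  have hpower : ∀ P ω a, NetworkMISO.rowNorm ((NetworkMISO.cdzf V (μ P) (F P)).precoder
      (NetworkMISO.estimates α H Δ P ω)) a ≤ 1 := fun P ω a =>
    NetworkMISO.rowNorm_precoder_le (hF_power P) _ a
  have hest : ∀ P, 1 ≤ P → AEMeasurable (NetworkMISO.estimates α H Δ P) Pr := fun P hP =>
    aemeasurable_pi_iff.2 fun j => (hmodel.hasLaw_estimate j hP (hα_pos j).le).aemeasurable
  have hintV : ∀ P, 1 ≤ P → ∀ i, Integrable (fun ω =>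
      NetworkMISO.instRate P (H ω) (V (NetworkMISO.estimates α H Δ P ω 0)) i) Pr := fun P hP i =>
    NetworkMISO.integrable_instRate (by linarith) hmodel.channel
      (hV.measurable.comp_aemeasurable (aemeasurable_pi_iff.1 (hest P hP) 0))
      (fun ω a => hV.power _ a) i
  have hintT : ∀ P, 1 ≤ P → ∀ i, Integrable (fun ω => NetworkMISO.instRate P (H ω)
      ((NetworkMISO.cdzf V (μ P) (F P)).precoder (NetworkMISO.estimates α H Δ P ω)) i) Pr :=
    fun P hP i => NetworkMISO.integrable_instRate (by linarith) hmodel.channel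
      ((NetworkMISO.measurable_precoder hV (μ P) (hF_meas P)).comp_aemeasurable (hest P hP))
      (hpower P) i
  refine ⟨hpower, fun P hP i => ⟨hintV P hP i, hintT P hP i⟩, fun P _ => ae_of_all _ fun ω j hj =>
    NetworkMISO.cdzf_eq_predicted hV (hμ P).1.le (hμ P).2.le (F P) _ hj, ?_, ?_⟩
  · obtain ⟨ε, hε, h⟩ := NetworkMISO.eventually_whp.1 (NetworkMISO.eventually_not_inOutage hV hmodel
      hαμ_pos.le hαμ_lt hμ hμ_rate.isBigO_symm)
    simp only [not_forall, not_not] at h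
    exact h.trans_isLittleO (NetworkMISO.rpow_neg_isLittleO_inv_logb hε)
  · have hlim : ∀ i, Tendsto (fun P => ∫ ω,
        (NetworkMISO.instRate P (H ω) (V (NetworkMISO.estimates α H Δ P ω 0)) i -
          NetworkMISO.instRate P (H ω) ((NetworkMISO.cdzf V (μ P) (F P)).precoder
            (NetworkMISO.estimates α H Δ P ω)) i) ∂Pr) atTop (nhds 0) := by
      intro i
      obtain ⟨η, hη, hwhp⟩ := NetworkMISO.eventually_abs_instRate_sub_le hN hV hsignal hmodel
        hαμ_pos hαμ_lt hμ hμ_rate F i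
      refine NetworkMISO.tendsto_integral_zero_of_whp
        (Y := fun ω => 2 / Real.log 2 * ∑ a, ‖H ω i a‖)
        (fun P hP => (hintV P hP i).sub (hintT P hP i))
        ((integrable_finsetSum _ fun a _ =>
          NetworkMISO.integrable_norm_entry hmodel.channel i a).const_mul _)
        (fun P hP ω => ?_) hη hwhp
      have hP0 : 0 ≤ P := by linarith
      exact abs_sub_le_of_nonneg_of_le (NetworkMISO.instRate_nonneg hP0 _ _ _)
        (NetworkMISO.instRate_le hP0 _ (hV.power _) i) (NetworkMISO.instRate_nonneg hP0 _ _ _)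
        (NetworkMISO.instRate_le hP0 _ (hpower P ω) i)
    have hsum := tendsto_finsetSum Finset.univ fun i _ => hlim i
    rw [Finset.sum_const_zero] at hsum
    refine hsum.congr' ?_
    filter_upwards [eventually_ge_atTop 1] with P hP
    rw [NetworkMISO.sumRate, NetworkMISO.sumRate, ← Finset.sum_sub_distrib]
    exact Finset.sum_congr rfl fun i _ => integral_sub (hintV P hP i) (hintT P hP i)
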